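/- **Setting.** Let $\Lambda$ be the finite vertex set of a connected graph with graph distance $\mathsf d$; $\operatorname{diam}S=\max_{i,j\in S}\mathsf d(i,j)$, and $\partial S$ is the set of sites of $S$ adjacent to $S^{\rm c}=\Lambda\setminus S$. Let $d\ge1$ be an integer and assume that the graph is $d$-dimensional with constant $c_d>0$: $|\partial S|\le c_d\max(1,\operatorname{diam}S)^{d-1}$ and $|S|\le c_d\max(1,\operatorname{diam}S)^{d}$ for every connected $S\subset\Lambda$. Each site carries a qudit of dimension $q$. Let $H_0'=\sum_f\lambda_f(I-P_f)$, where the $P_f$ are commuting orthogonal projectors, $P_f$ is supported on a set (also denoted $f$; several factors may share one set) of diameter at most $\ell_0$, $\lambda_f\ge\Delta'>0$, and $\prod_fP_f\ne0$. For $S\subset\Lambda$ put $P_S=\prod_{f\subset S}P_f$. An operator has *syndrome* $\mathbf s$ (a set of factors) if it anticommutes with $2P_f-I$ for $f\in\mathbf s$ and commutes with it for $f\notin\mathbf s$. An operator is *strongly supported* in $S$ if it is supported in $S$ and commutes with every $P_f$, $f\not\subset S$. A ground state $|\psi_0\rangle\neq0$ (i.e. $P_\Lambda|\psi_0\rangle=|\psi_0\rangle$)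 is *$R'$-locally nondegenerate* if for every $S\subset\Lambda$ with $|S|\le c_d(R')^d$, every $\mathcal O$ strongly supported in $S$ with a syndrome $\mathbf s$ consisting of factors contained in $S$, and every $F\subset S$ (possibly empty) that meets all $f\in\mathbf s$ and is such that each connected component of $S\setminus F$ is adjacent to $S^{\rm c}$, there is an operator $\widetilde{\mathcal O}$ supported in $F$ with the same syndrome $\mathbf s$, $\|\widetilde{\mathcal O}\|\le\|\mathcal O\|$ and $\mathcal O|\psi_0\rangle=\widetilde{\mathcal O}|\psi_0\rangle$. Let $D'=\sum_{S,\mathbf s}D'_{S,\mathbf s}$ be Hermitian, where $S$ runs over connected sets with $\operatorname{diam}S\le\ell_D'$ and $\mathbf s$ over sets of factors contained in $S$, and $D'_{S,\mathbf s}$ is strongly supported in $S$ with syndrome $\mathbf s$. Assume that $D'$ is locally block-diagonal, $[D'_{S,\mathbf s},P_S]=0$, and annihilates $|\psi_0\rangle$ term by term, $D'_{S,\mathbf s}|\psi_0\rangle=0$. Let $\mathbb d'=\max_{i\in\Lambda}\sum_{S\ni i,\,\mathbf s}\|D'_{S,\mathbf s}\|>0$. Write $\langle\mathcal O\rangle_{\psi}=\langle\psi|\mathcal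 O|\psi\rangle/\langle\psi|\psi\rangle$, and $H[|\psi\rangle]=\langle\psi|H|\psi\rangle/\langle\psi|\psi\rangle$ for $|\psi\rangle\neq0$, $H[0]=+\infty$. **Theorem.** For all $d,c_d,\ell_0,\ell_D'$ and every $c_d'>0$ there is a constant $c_{\rm R}>0$, depending only on these five quantities, such that the following holds for all systems as above. Put $R=c_{\rm R}\Delta'/\mathbb d'$ and $H_0=H_0'+D'$. Suppose that $|\psi_0\rangle$ is an $R'$-locally nondegenerate ground state of $H_0'$ with $R<R'$, and that the boundary-volume inequality $|\partial F|\ge c_d'|F|^{1-1/d}$ holds for every connected $F\subset\Lambda$ with $|F|\le c_dR^d$. Then $(H_0,|\psi_0\rangle)$ is metastable in volume: $H_0[|\psi_0\rangle]=0$, and $$H_0\big[(\mathcal O-\langle\mathcal O\rangle_{\psi_0})|\psi_0\rangle\big]\ \ge\ \Delta'/2\qquad\text{for every }\mathcal O\text{ strongly supported in some }S\text{ with }|S|\le c_dR^d .$$ Moreover $D'$ is relatively bounded by $H_0'$ on local excitations: $\|D'|\psi\rangle\|\le\frac12\|H_0'|\psi\rangle\|$ for every $|\psi\rangle$ in the linear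 span of all vectors $(\mathcal O-\langle\mathcal O\rangle_{\psi_0})|\psi_0\rangle$ with $\mathcal O$ strongly supported in some $S$, $|S|\le c_dR^d$. -/

import Mathlib

noncomputable section

namespace Metastable

/-! ### Geometry of the graph of sites -/

section Geometry

variable {Λ : Type} (G : SimpleGraph Λ)

/-- A finite set of sites is connected: it is nonempty and any two of its sites are joined by a
path inside the set. -/
def IsConn (S : Finset Λ) : Prop := (G.induce (S : Set Λ)).Connected

/-- The diameter of a finite set of sites, in the graph distance of the whole graph. -/
def setDiam (S : Finset Λ) : ℕ := S.sup fun i => S.sup fun j => G.dist i j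

open Classical in
/-- The boundary of `S`: the sites of `S` at distance one from the complement of `S`. -/
def bdry (S : Finset Λ) : Finset Λ := S.filter fun i => ∃ j, j ∉ S ∧ G.Adj i j

/-- The graph is `d`-dimensional with constant `c`. -/
def IsDimensional (d : ℕ) (c : ℝ) : Prop :=
  ∀ S : Finset Λ, IsConn G S →
    ((bdry G S).card : ℝ) ≤ c * (max 1 (setDiam G S) : ℝ) ^ (d - 1) ∧
      (S.card : ℝ) ≤ c * (max 1 (setDiam G S) : ℝ) ^ d

/-- The boundary-volume inequality `|∂F| ≥ c |F|^(1-1/d)` for all connected `F` of at most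
`n` sites. -/
def HasBoundaryGrowth (d : ℕ) (c n : ℝ) : Prop :=
  ∀ F : Finset Λ, IsConn G F → (F.card : ℝ) ≤ n →
    c * (F.card : ℝ) ^ (1 - 1 / (d : ℝ)) ≤ ((bdry G F).card : ℝ)

end Geometry

/-! ### Qudits on the sites -/

section Qudits

variable {Λ : Type} [Fintype Λ] [DecidableEq Λ] {q : ℕ}

/-- The Hilbert space of one `q`-level system on every site; the coordinates are the amplitudes
in the computational basis. -/
abbrev Hilb (Λ : Type) [Fintype Λ] [DecidableEq Λ] (q : ℕ) : Type :=
  EuclideanSpace ℂ (Λ → Fin q)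

/-- The operators on the Hilbert space, with the operator norm. -/
abbrev Op (Λ : Type) [Fintype Λ] [DecidableEq Λ] (q : ℕ) : Type :=
  Hilb Λ q →L[ℂ] Hilb Λ q

/-- The matrix element of `O` between the computational basis states `x` (row), `y` (column). -/
def entry (O : Op Λ q) (x y : Λ → Fin q) : ℂ := O (EuclideanSpace.single y (1 : ℂ)) x

open Classical in
/-- `O` is supported in `S`: it is the tensor product of an operator `A` on the qudits in `S` and
of the identity on the other qudits. -/
def SupportedIn (O : Op Λ q) (S : Finset Λ) : Prop :=
  ∃ A : Matrix (S → Fin q) (S → Fin q) ℂ, ∀ x y : Λ → Fin q,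
    entry O x y = if ∀ i, i ∉ S → x i = y i then A (fun i => x i) (fun i => y i) else 0

/-- The expectation value of `O` in a (not necessarily normalized) state `ψ`. -/
def expect (O : Op Λ q) (ψ : Hilb Λ q) : ℂ := inner ℂ ψ (O ψ) / inner ℂ ψ ψ

/-- The fluctuation `(O - ⟨O⟩_ψ) ψ`. -/
def fluct (O : Op Λ q) (ψ : Hilb Λ q) : Hilb Λ q := O ψ - expect O ψ • ψ

open Classical in
/-- The average energy of an unnormalized state, with value `+∞` at the zero vector. -/
def avgEnergy (H : Op Λ q) (ψ : Hilb Λ q) : EReal :=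
  if ψ = 0 then ⊤ else (((expect H ψ).re : ℝ) : EReal)

end Qudits

/-! ### Commuting projector Hamiltonians and syndromes -/

section Models

variable {Λ : Type} [Fintype Λ] [DecidableEq Λ]

/-- A frustration-free commuting projector Hamiltonian `∑ f, λ_f (1 - P_f)` of range `ℓ₀` and with
all `λ_f ≥ Δ`. The factors `f` are indexed by `ι`; several of them may have the same support. -/
structure CommProjModel (G : SimpleGraph Λ) (q : ℕ) (ι : Type) [Fintype ι] (ℓ₀ : ℕ) (Δ : ℝ) where
  /-- the set of sites on which a factor acts -/
  supp : ι → Finset Λ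
  /-- the local projectors `P_f` -/
  proj : ι → Op Λ q
  /-- the couplings `λ_f` -/
  coupling : ι → ℝ
  isProj : ∀ f, IsStarProjection (proj f)
  supported : ∀ f, SupportedIn (proj f) (supp f)
  range_le : ∀ f, setDiam G (supp f) ≤ ℓ₀
  comm : ∀ f g, Commute (proj f) (proj g)
  le_coupling : ∀ f, Δ ≤ coupling f
  frustrationFree : Finset.univ.noncommProd proj (fun f _ g _ _ => comm f g) ≠ 0

variable {G : SimpleGraph Λ} {q : ℕ} {ι : Type} [Fintype ι] {ℓ₀ : ℕ} {Δ : ℝ}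

namespace CommProjModel

variable (M : CommProjModel G q ι ℓ₀ Δ)

/-- The Hamiltonian `∑ f, λ_f (1 - P_f)`. -/
def ham : Op Λ q := ∑ f, (M.coupling f : ℂ) • (1 - M.proj f)

/-- The local ground state projector `P_S`, the product of all `P_f` with `f ⊆ S`. -/
def localProj (S : Finset Λ) : Op Λ q :=
  (Finset.univ.filter fun f => M.supp f ⊆ S).noncommProd M.proj (fun f _ g _ _ => M.comm f g)

/-- `ψ` is a ground state: it is a nonzero vector fixed by the product of all `P_f`. -/
def IsGroundState (ψ : Hilb Λ q) : Prop := ψ ≠ 0 ∧ M.localProj Finset.univ ψ = ψ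

/-- `O` has syndrome `s`: it anticommutes with the checks `2 P_f - 1`, `f ∈ s`, and commutes with
the other checks. -/
def HasSyndrome (O : Op Λ q) (s : Finset ι) : Prop :=
  (∀ f ∈ s, O * (2 * M.proj f - 1) = -((2 * M.proj f - 1) * O)) ∧
    ∀ f, f ∉ s → O * (2 * M.proj f - 1) = (2 * M.proj f - 1) * O

/-- `O` is strongly supported in `S`: it is supported in `S` and commutes with every `P_f` whose
factor is not contained in `S`. -/
def StronglySupported (O : Op Λ q) (S : Finset Λ) : Prop :=
  SupportedIn O S ∧ ∀ f, ¬ M.supp f ⊆ S → Commute (M.proj f) O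

/-- `ψ` is `R'`-locally nondegenerate; `c` and `d` are the constants of the graph. The condition
on `S \ F` says that each connected component of it has a neighbour outside of `S`. -/
def LocallyNondegenerate (d : ℕ) (c R' : ℝ) (ψ : Hilb Λ q) : Prop :=
  ∀ (S : Finset Λ) (s : Finset ι) (O : Op Λ q), (S.card : ℝ) ≤ c * R' ^ d →
    M.StronglySupported O S → M.HasSyndrome O s → (∀ f ∈ s, M.supp f ⊆ S) →
    ∀ F ⊆ S, (∀ f ∈ s, (M.supp f ∩ F).Nonempty) →
      (∀ i : ((S \ F : Finset Λ) : Set Λ), ∃ j : ((S \ F : Finset Λ) : Set Λ),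
        (G.induce ((S \ F : Finset Λ) : Set Λ)).Reachable i j ∧
          ∃ k, k ∉ S ∧ G.Adj (j : Λ) k) →
      ∃ O' : Op Λ q, SupportedIn O' F ∧ M.HasSyndrome O' s ∧ ‖O'‖ ≤ ‖O‖ ∧ O ψ = O' ψ

/-- `D S s` are the terms of a decomposition of an operator over connected sets `S` and
syndromes `s`, each term being strongly supported in `S`. -/
def IsSyndromeDecomposition (D : Finset Λ → Finset ι → Op Λ q) : Prop :=
  ∀ S s, D S s ≠ 0 → IsConn G S ∧ (∀ f ∈ s, M.supp f ⊆ S) ∧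
    M.StronglySupported (D S s) S ∧ M.HasSyndrome (D S s) s

/-- Every term commutes with the local ground state projector of its set. -/
def IsLocallyBlockDiagonal (D : Finset Λ → Finset ι → Op Λ q) : Prop :=
  ∀ S s, Commute (D S s) (M.localProj S)

/-- The span of the fluctuations `(O - ⟨O⟩_ψ) ψ` over all operators `O` that are strongly supported
in a set of at most `n` sites. -/
def excitations (ψ : Hilb Λ q) (n : ℝ) : Submodule ℂ (Hilb Λ q) :=
  Submodule.span ℂ {φ | ∃ (S : Finset Λ) (O : Op Λ q), (S.card : ℝ) ≤ n ∧
    M.StronglySupported O S ∧ φ = fluct O ψ}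

end CommProjModel

/-- The operator `∑ S, ∑ s, D S s`. -/
def total (D : Finset Λ → Finset ι → Op Λ q) : Op Λ q := ∑ S, ∑ s, D S s

/-- The terms vanish on sets of diameter larger than `ℓ`. -/
def HasRange (G : SimpleGraph Λ) (D : Finset Λ → Finset ι → Op Λ q) (ℓ : ℕ) : Prop :=
  ∀ S s, D S s ≠ 0 → setDiam G S ≤ ℓ

/-- The local norm at `K = 0`: the maximum over the sites `i` of the sum of the norms of all terms
whose set contains `i`. -/
def localNorm (D : Finset Λ → Finset ι → Op Λ q) : ℝ :=
  ⨆ i : Λ, ∑ S with i ∈ S, ∑ s, ‖D S s‖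

end Models

end Metastable

end

noncomputable section
namespace Metastable

/-! ### Components, fillings and boundary-volume counting -/

section Geometry

variable {Λ : Type} {G : SimpleGraph Λ}

/-! The checks `2 P_f - 1` split the Hilbert space into orthogonal syndrome sectors, and on the
sector of `s` the unperturbed energy is `E_s = ∑_{f ∈ s} λ_f ≥ Δ |s|`. An excitation is a sum of
sector vectors `φ_s` with `φ_∅ = 0`, each spanned by images of `ψ₀` under operators of syndrome `s`
on at most `n = c_d R^d` sites (`exists_sum_of_mem_excitations`). It remains to dominate `D` by a
small multiple of `E_s`, sector by sector.

The main point is that only terms of `D` near the errors act on `φ_s` (`active`). By local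
nondegeneracy, each operator creating `φ_s` may be replaced by one supported in the filling of the
error sites `B`: `B` together with the components of its complement of at most `n` sites. A term
away from the filling commutes with the replacement and kills `ψ₀`. By the boundary-volume
inequality a small component has at most `n^(1/d) / c` times as many sites as its boundary, and its
boundary is adjacent to `B`; so for `n ≥ 1` filling multiplies the number of sites by at most a
constant times `R` (`card_filled_le`). The norms of the active terms thus sum to at most a constant
times `localNorm D * R * |s|`, which is at most `ε Δ |s| ≤ ε E_s` for a suitable `c_R`.

A term of syndrome `s'` sends sector `s` to `symmDiff s s'`, so Schur tests turn these counts into a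
form bound (`norm_inner_sum_le`), which gives the energy bound, and a norm bound
(`norm_sq_sum_sum_le`), which gives relative boundedness. The latter also compares the weights of
source and target; their ratio is bounded because one term changes errors only inside a set of
bounded size. -/

lemma setDiam_le_iff {S : Finset Λ} {n : ℕ} :
    setDiam G S ≤ n ↔ ∀ i ∈ S, ∀ j ∈ S, G.dist i j ≤ n := by
  simp [setDiam, Finset.sup_le_iff]

lemma IsConn.nonempty {S : Finset Λ} (h : IsConn G S) : S.Nonempty := by
  obtain ⟨⟨i, hi⟩⟩ := SimpleGraph.Connected.nonempty h
  exact ⟨i, by simpa using hi⟩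

lemma mem_bdry {S : Finset Λ} {i : Λ} : i ∈ bdry G S ↔ i ∈ S ∧ ∃ j, j ∉ S ∧ G.Adj i j := by
  classical
  simp [bdry]

/-- The finite set is connected if all its sites can be joined to a given one. -/
lemma isConn_of_reachable {S : Finset Λ} {i : Λ} (hi : i ∈ S)
    (h : ∀ j (hj : j ∈ S), (G.induce (S : Set Λ)).Reachable ⟨j, hj⟩ ⟨i, hi⟩) : IsConn G S := by
  have : Nonempty (S : Set Λ) := ⟨⟨i, hi⟩⟩
  exact ⟨fun a b => (h a a.2).trans (h b b.2).symm⟩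

/-- `j` can be reached from `i` by steps along edges that end in `A`. -/
def ReachIn (G : SimpleGraph Λ) (A : Finset Λ) : Λ → Λ → Prop :=
  Relation.ReflTransGen fun i j => G.Adj i j ∧ j ∈ A

lemma ReachIn.mem {A : Finset Λ} {i j : Λ} (h : ReachIn G A i j) (hi : i ∈ A) : j ∈ A := by
  rcases Relation.ReflTransGen.cases_tail h with rfl | ⟨k, -, hk⟩
  · exact hi
  · exact hk.2

lemma ReachIn.symm {A : Finset Λ} {i j : Λ} (h : ReachIn G A i j) (hi : i ∈ A) :
    ReachIn G A j i := by
  induction h with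
  | refl => exact .refl
  | tail hab hbc ih => exact .head ⟨hbc.1.symm, ReachIn.mem hab hi⟩ ih

variable [Fintype Λ]

open Classical in
/-- The ball of radius `r` around `i`. -/
def distBall (G : SimpleGraph Λ) (i : Λ) (r : ℕ) : Finset Λ :=
  Finset.univ.filter fun j => G.dist j i ≤ r

lemma mem_distBall {i j : Λ} {r : ℕ} : j ∈ distBall G i r ↔ G.dist j i ≤ r := by
  simp [distBall]

/-- A shortest path to the centre never leaves the ball. -/
lemma isConn_distBall (hG : G.Connected) (i : Λ) (r : ℕ) : IsConn G (distBall G i r) := by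
  have key : ∀ (j k : Λ) (p : G.Walk j k) (hp : ∀ m ∈ p.support, m ∈ distBall G i r),
      (G.induce (distBall G i r : Set Λ)).Reachable ⟨j, hp j p.start_mem_support⟩
        ⟨k, hp k p.end_mem_support⟩ := by
    intro j k p hp
    exact ⟨p.induce _ hp⟩
  have hlen : ∀ (j k : Λ) (p : G.Walk j k), ∀ m ∈ p.support, G.dist m k ≤ p.length := by
    intro j k p
    induction p with
    | nil => simp
    | cons h q ih =>
      intro m hm
      rw [SimpleGraph.Walk.support_cons, List.mem_cons] at hm
      rcases hm with rfl | hm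
      · exact SimpleGraph.dist_le (SimpleGraph.Walk.cons h q)
      · exact (ih m hm).trans (by simp)
  refine isConn_of_reachable (i := i) (by simp [mem_distBall]) fun j hj => ?_
  obtain ⟨p, hp⟩ := hG.exists_walk_length_eq_dist j i
  exact key j i p fun m hm =>
    mem_distBall.2 ((hlen j i p m hm).trans (hp.le.trans (mem_distBall.1 hj)))

lemma IsDimensional.card_distBall_le {d : ℕ} {c : ℝ} (h : IsDimensional G d c) (hc : 0 < c)
    (hG : G.Connected) (i : Λ) (r : ℕ) :
    ((distBall G i r).card : ℝ) ≤ c * (max 1 (2 * r : ℝ)) ^ d := by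
  refine (h _ (isConn_distBall hG i r)).2.trans ?_
  have : setDiam G (distBall G i r) ≤ 2 * r := by
    rw [setDiam_le_iff]
    intro j hj k hk
    rw [mem_distBall] at hj hk
    have := hG.dist_triangle (u := j) (v := i) (w := k)
    rw [SimpleGraph.dist_comm (u := i)] at this
    omega
  have h2 : (setDiam G (distBall G i r) : ℝ) ≤ 2 * r := by exact_mod_cast this
  gcongr

/-- The dimension bound covers only connected sets, which supports of factors need not be. Enclosing
the set in a ball removes this restriction at the cost of doubling the diameter. -/
lemma IsDimensional.card_le_of_setDiam_le {d : ℕ} {c : ℝ} (h : IsDimensional G d c) (hc : 0 < c)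
    (hG : G.Connected) {S : Finset Λ} {r : ℕ} (hS : setDiam G S ≤ r) :
    (S.card : ℝ) ≤ c * (max 1 (2 * r : ℝ)) ^ d := by
  rcases S.eq_empty_or_nonempty with rfl | ⟨i, hi⟩
  · simp only [Finset.card_empty, Nat.cast_zero]; positivity
  · refine le_trans ?_ (h.card_distBall_le hc hG i r)
    exact_mod_cast Finset.card_le_card fun j hj =>
      mem_distBall.2 (setDiam_le_iff.1 hS j hj i hi)

open Classical in
/-- The sites that can be reached from `i` inside `A`. -/
def comp (G : SimpleGraph Λ) (A : Finset Λ) (i : Λ) : Finset Λ :=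
  Finset.univ.filter fun j => ReachIn G A i j

lemma mem_comp {A : Finset Λ} {i j : Λ} : j ∈ comp G A i ↔ ReachIn G A i j := by simp [comp]

lemma self_mem_comp {A : Finset Λ} {i : Λ} : i ∈ comp G A i := mem_comp.2 .refl

lemma comp_subset {A : Finset Λ} {i : Λ} (hi : i ∈ A) : comp G A i ⊆ A :=
  fun _ hj => (mem_comp.1 hj).mem hi

lemma comp_eq_of_mem {A : Finset Λ} {i j : Λ} (hi : i ∈ A) (hj : j ∈ comp G A i) :
    comp G A j = comp G A i := by
  ext k
  rw [mem_comp] at *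
  rw [mem_comp]
  exact ⟨fun h => hj.trans h, fun h => (hj.symm hi).trans h⟩

lemma isConn_comp {A : Finset Λ} {i : Λ} : IsConn G (comp G A i) := by
  refine isConn_of_reachable self_mem_comp fun j hj => ?_
  have h := mem_comp.1 hj
  induction h with
  | refl => exact .refl _
  | @tail b c hab hbc ih =>
    have hb : b ∈ comp G A i := mem_comp.2 hab
    refine SimpleGraph.Reachable.trans (SimpleGraph.Adj.reachable ?_) (ih hb)
    exact hbc.1.symm

variable [DecidableEq Λ]

open Classical in
/-- The set `B` together with all the components of its complement with at most `n` sites. -/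
def filled (G : SimpleGraph Λ) (n : ℝ) (B : Finset Λ) : Finset Λ :=
  Finset.univ.filter fun i => i ∈ B ∨ ((comp G Bᶜ i).card : ℝ) ≤ n

lemma mem_filled {n : ℝ} {B : Finset Λ} {i : Λ} :
    i ∈ filled G n B ↔ i ∈ B ∨ ((comp G Bᶜ i).card : ℝ) ≤ n := by simp [filled]

lemma subset_filled {n : ℝ} {B : Finset Λ} : B ⊆ filled G n B := fun _ h => mem_filled.2 (.inl h)

omit [Fintype Λ] [DecidableEq Λ] in
-- Split `|F| = |F|^(1-1/d) |F|^(1/d)`; the boundary controls the first factor and `n` the second.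
lemma HasBoundaryGrowth.card_le {d : ℕ} {c n : ℝ} (hc : 0 < c)
    (h : HasBoundaryGrowth G d c n) {F : Finset Λ} (hF : IsConn G F) (hFn : (F.card : ℝ) ≤ n) :
    (F.card : ℝ) ≤ n ^ (1 / (d : ℝ)) / c * (bdry G F).card := by
  have h1 := h F hF hFn
  have hpos : (0 : ℝ) < F.card := by exact_mod_cast hF.nonempty.card_pos
  have h2 : (F.card : ℝ) = (F.card : ℝ) ^ (1 - 1 / (d : ℝ)) * (F.card : ℝ) ^ (1 / (d : ℝ)) := by
    rw [← Real.rpow_add hpos]; simp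
  have h3 : (F.card : ℝ) ^ (1 / (d : ℝ)) ≤ n ^ (1 / (d : ℝ)) :=
    Real.rpow_le_rpow hpos.le hFn (by positivity)
  calc (F.card : ℝ) = (c * (F.card : ℝ) ^ (1 - 1 / (d : ℝ))) * (F.card : ℝ) ^ (1 / (d : ℝ)) / c := by
        rw [mul_assoc, ← h2, mul_div_cancel_left₀ _ hc.ne']
    _ ≤ (bdry G F).card * n ^ (1 / (d : ℝ)) / c := by clear h2; gcongr
    _ = _ := by ring

/-- The sites outside of `B` in small components of the complement of `B` are controlled by the
number of sites of `B`. -/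
lemma card_filled_le {d : ℕ} {c n δ : ℝ} (hc : 0 < c) (hn : 0 ≤ n)
    (h : HasBoundaryGrowth G d c n) (hδ : ∀ i, ((distBall G i 1).card : ℝ) ≤ δ) (B : Finset Λ) :
    ((filled G n B).card : ℝ) ≤ (1 + n ^ (1 / (d : ℝ)) / c * δ) * B.card := by
  classical
  set κ := n ^ (1 / (d : ℝ)) / c
  have hκ : 0 ≤ κ := by positivity
  set X := filled G n B \ B with hX
  have memX : ∀ i, i ∈ X ↔ i ∉ B ∧ ((comp G Bᶜ i).card : ℝ) ≤ n := by
    intro i; simp only [hX, Finset.mem_sdiff, mem_filled]; tauto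
  set Y := B.biUnion fun b => distBall G b 1 with hY
  set Q := X.image (comp G Bᶜ) with hQ
  have hcomp : ∀ i ∈ X, ∀ j ∈ comp G Bᶜ i, j ∈ X ∧ comp G Bᶜ j = comp G Bᶜ i := by
    intro i hi j hj
    have hiB : i ∈ Bᶜ := Finset.mem_compl.2 ((memX i).1 hi).1
    have e := comp_eq_of_mem hiB hj
    refine ⟨(memX j).2 ⟨Finset.mem_compl.1 (comp_subset hiB hj), ?_⟩, e⟩
    rw [e]; exact ((memX i).1 hi).2
  have hfib : ∀ C ∈ Q, X.filter (fun x => comp G Bᶜ x = C) = C := by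
    intro C hC
    obtain ⟨i, hi, rfl⟩ := Finset.mem_image.1 hC
    ext j
    simp only [Finset.mem_filter]
    exact ⟨fun hj => hj.2 ▸ self_mem_comp, fun hj => hcomp i hi j hj⟩
  -- A neighbour of a component that lies outside of it must be in `B`, so boundary sites are within
  -- distance one of `B`.
  have hbd : ∀ C ∈ Q, bdry G C ⊆ (X ∩ Y).filter (fun x => comp G Bᶜ x = C) := by
    intro C hC
    obtain ⟨i, hi, rfl⟩ := Finset.mem_image.1 hC
    intro j hj
    obtain ⟨hj, k, hk, hjk⟩ := mem_bdry.1 hj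
    have := hcomp i hi j hj
    have hkB : k ∈ B := by
      by_contra hkB
      exact hk (mem_comp.2 ((mem_comp.1 hj).tail ⟨hjk, Finset.mem_compl.2 hkB⟩))
    simp only [Finset.mem_filter, Finset.mem_inter]
    refine ⟨⟨this.1, Finset.mem_biUnion.2 ⟨k, hkB, mem_distBall.2 ?_⟩⟩, this.2⟩
    exact (SimpleGraph.dist_eq_one_iff_adj.2 hjk).le
  -- Both sides are counted component by component, so boundaries of different components are not
  -- counted twice.
  have hXle : (X.card : ℝ) ≤ κ * (X ∩ Y).card := by
    rw [Finset.card_eq_sum_card_fiberwise (s := X) (t := Q) (f := comp G Bᶜ)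
        (fun x hx => Finset.mem_image_of_mem _ hx),
      Finset.card_eq_sum_card_fiberwise (s := X ∩ Y) (t := Q) (f := comp G Bᶜ)
        (fun x hx => Finset.mem_image_of_mem _ (Finset.mem_inter.1 hx).1)]
    push_cast
    rw [Finset.mul_sum]
    refine Finset.sum_le_sum fun C hC => ?_
    rw [hfib C hC]
    have hle : ((bdry G C).card : ℝ) ≤
        (((X ∩ Y).filter fun x => comp G Bᶜ x = C).card : ℝ) := by
      exact_mod_cast Finset.card_le_card (hbd C hC)
    obtain ⟨i, hi, rfl⟩ := Finset.mem_image.1 hC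
    have hi' := (memX i).1 hi
    exact (h.card_le hc isConn_comp hi'.2).trans
      (mul_le_mul_of_nonneg_left hle hκ)
  have hYle : (Y.card : ℝ) ≤ δ * B.card := by
    calc (Y.card : ℝ) ≤ ((∑ b ∈ B, (distBall G b 1).card : ℕ) : ℝ) := by
          exact_mod_cast Finset.card_biUnion_le
      _ ≤ ∑ _b ∈ B, δ := by push_cast; exact Finset.sum_le_sum fun b _ => hδ b
      _ = δ * B.card := by simp [mul_comm]
  have hXY : ((X ∩ Y).card : ℝ) ≤ Y.card := by
    exact_mod_cast Finset.card_le_card Finset.inter_subset_right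
  have hsum : (filled G n B).card = X.card + B.card := by
    rw [hX, Finset.card_sdiff_add_card_eq_card subset_filled]
  rw [hsum]
  push_cast
  nlinarith [mul_le_mul_of_nonneg_left (hXY.trans hYle) hκ]

/-- A subset `F` of `S` that contains `B`, lies in the filling of `B` and is such that every
component of `S \ F` is adjacent to the complement of `S`. -/
lemma exists_subset_filled {n : ℝ} {S B : Finset Λ} (hS : (S.card : ℝ) ≤ n) (hB : B ⊆ S) :
    ∃ F ⊆ S, B ⊆ F ∧ F ⊆ filled G n B ∧
      ∀ i : ((S \ F : Finset Λ) : Set Λ), ∃ j : ((S \ F : Finset Λ) : Set Λ),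
        (G.induce ((S \ F : Finset Λ) : Set Λ)).Reachable i j ∧
          ∃ k, k ∉ S ∧ G.Adj (j : Λ) k := by
  classical
  -- `F` keeps `B` and the sites of `S` that cannot escape from `S` while avoiding `B`. The
  -- component in `Bᶜ` of a trapped site outside `B` stays in `S`, hence has at most `n` sites.
  let esc : Λ → Prop := fun i => ∃ j, ReachIn G (S \ B) i j ∧ ∃ k, k ∉ S ∧ G.Adj j k
  let F := S.filter fun i => i ∈ B ∨ ¬ esc i
  have memSF : ∀ i, i ∈ S \ F ↔ i ∈ S \ B ∧ esc i := by
    intro i; simp only [F, Finset.mem_sdiff, Finset.mem_filter]; by_cases h : esc i <;> simp [h]; tauto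
  refine ⟨F, Finset.filter_subset _ _, fun i hi => Finset.mem_filter.2 ⟨hB hi, .inl hi⟩, ?_, ?_⟩
  · intro i hi
    obtain ⟨hiS, hi⟩ := Finset.mem_filter.1 hi
    rw [mem_filled]
    by_cases hiB : i ∈ B
    · exact .inl hiB
    right
    have hesc : ¬ esc i := hi.resolve_left hiB
    refine le_trans ?_ hS
    have : comp G Bᶜ i ⊆ S := by
      intro j hj
      have key : ReachIn G (S \ B) i j := by
        have h := mem_comp.1 hj
        clear hj
        induction h with
        | refl => exact .refl
        | @tail b c hab hbc ih =>
          refine ih.tail ⟨hbc.1, ?_⟩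
          rw [Finset.mem_sdiff]
          refine ⟨?_, by simpa using hbc.2⟩
          by_contra hc
          exact hesc ⟨b, ih, c, hc, hbc.1⟩
      exact (Finset.mem_sdiff.1 (key.mem (Finset.mem_sdiff.2 ⟨hiS, hiB⟩))).1
    exact_mod_cast Finset.card_le_card this
  · rintro ⟨i, hi⟩
    obtain ⟨hi1, j, hij, hk⟩ := (memSF i).1 hi
    have hj1 := hij.mem hi1
    have hj : j ∈ S \ F := (memSF j).2 ⟨hj1, j, .refl, hk⟩
    refine ⟨⟨j, hj⟩, ?_, hk⟩
    have key : ∀ (a : Λ), ReachIn G (S \ B) a j → a ∈ S \ B → ∃ ha : a ∈ S \ F,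
        (G.induce ((S \ F : Finset Λ) : Set Λ)).Reachable ⟨a, ha⟩ ⟨j, hj⟩ := by
      intro a haj
      induction haj using Relation.ReflTransGen.head_induction_on with
      | refl => exact fun _ => ⟨hj, .refl _⟩
      | @head a b hab hbj ih =>
        intro ha
        obtain ⟨hb, hr⟩ := ih hab.2
        have ha' : a ∈ S \ F := (memSF a).2 ⟨ha, j, .head hab hbj, hk⟩
        exact ⟨ha', SimpleGraph.Reachable.trans (SimpleGraph.Adj.reachable (by exact hab.1)) hr⟩
    exact (key i hij hi1).2

end Geometry

/-! ### Algebra of operators with given support -/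

section Supports

variable {Λ : Type} [Fintype Λ] [DecidableEq Λ] {q : ℕ}

lemma Op.ext_entry {A B : Op Λ q} (h : ∀ x y, entry A x y = entry B x y) : A = B := by
  apply ContinuousLinearMap.coe_injective
  refine (EuclideanSpace.basisFun (Λ → Fin q) ℂ).toBasis.ext fun y => ?_
  ext x
  simpa [entry] using h x y

lemma entry_mul (A B : Op Λ q) (x y : Λ → Fin q) :
    entry (A * B) x y = ∑ z, entry A x z * entry B z y := by
  have h : B (EuclideanSpace.single y (1 : ℂ)) =
      ∑ z, entry B z y • EuclideanSpace.single z (1 : ℂ) := by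
    ext x
    simp [entry, Finset.sum_apply, Pi.single_apply]
  change A (B (EuclideanSpace.single y 1)) x = _
  rw [h, map_sum, WithLp.ofLp_sum, Finset.sum_apply]
  refine Finset.sum_congr rfl fun z _ => ?_
  rw [map_smul, PiLp.smul_apply, smul_eq_mul, mul_comm]
  rfl

lemma entry_add (A B : Op Λ q) (x y : Λ → Fin q) :
    entry (A + B) x y = entry A x y + entry B x y := by simp [entry]

lemma entry_sub (A B : Op Λ q) (x y : Λ → Fin q) :
    entry (A - B) x y = entry A x y - entry B x y := by simp [entry]

lemma entry_smul (c : ℂ) (A : Op Λ q) (x y : Λ → Fin q) :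
    entry (c • A) x y = c * entry A x y := by simp [entry]

lemma entry_one (x y : Λ → Fin q) : entry (1 : Op Λ q) x y = if x = y then 1 else 0 := by
  simp [entry]

lemma SupportedIn.add {A B : Op Λ q} {S : Finset Λ} (hA : SupportedIn A S)
    (hB : SupportedIn B S) : SupportedIn (A + B) S := by
  obtain ⟨a, ha⟩ := hA
  obtain ⟨b, hb⟩ := hB
  refine ⟨a + b, fun x y => ?_⟩
  rw [entry_add, ha, hb]
  split_ifs <;> simp

lemma SupportedIn.sub {A B : Op Λ q} {S : Finset Λ} (hA : SupportedIn A S)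
    (hB : SupportedIn B S) : SupportedIn (A - B) S := by
  obtain ⟨a, ha⟩ := hA
  obtain ⟨b, hb⟩ := hB
  refine ⟨a - b, fun x y => ?_⟩
  rw [entry_sub, ha, hb]
  split_ifs <;> simp

lemma supportedIn_one (S : Finset Λ) : SupportedIn (1 : Op Λ q) S := by
  classical
  refine ⟨1, fun x y => ?_⟩
  rw [entry_one, Matrix.one_apply]
  by_cases h : x = y
  · simp [h]
  · by_cases h' : ∀ i, i ∉ S → x i = y i
    · rw [if_neg h, if_pos h', if_neg]
      intro e
      refine h (funext fun i => ?_)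
      by_cases hi : i ∈ S
      · exact congrFun e ⟨i, hi⟩
      · exact h' i hi
    · rw [if_neg h, if_neg h']

lemma SupportedIn.mono {A : Op Λ q} {S T : Finset Λ} (hA : SupportedIn A S) (h : S ⊆ T) :
    SupportedIn A T := by
  classical
  obtain ⟨a, ha⟩ := hA
  refine ⟨Matrix.of fun u v => if ∀ i : T, (i : Λ) ∉ S → u i = v i then
    a (fun i => u ⟨i, h i.2⟩) (fun i => v ⟨i, h i.2⟩) else 0, fun x y => ?_⟩
  rw [ha]
  simp only [Matrix.of_apply]
  by_cases h1 : ∀ i, i ∉ S → x i = y i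
  · rw [if_pos h1, if_pos fun i hi => h1 i fun hS => hi (h hS)]
    exact (if_pos fun (i : T) hi => h1 i hi).symm
  · rw [if_neg h1]
    by_cases h2 : ∀ i, i ∉ T → x i = y i
    · rw [if_pos h2, if_neg]
      intro h3
      refine h1 fun i hi => ?_
      by_cases hT : i ∈ T
      · exact h3 ⟨i, hT⟩ hi
      · exact h2 i hT
    · rw [if_neg h2]

lemma SupportedIn.mul {A B : Op Λ q} {S : Finset Λ} (hA : SupportedIn A S)
    (hB : SupportedIn B S) : SupportedIn (A * B) S := by
  classical
  obtain ⟨a, ha⟩ := hA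
  obtain ⟨b, hb⟩ := hB
  refine ⟨a * b, fun x y => ?_⟩
  rw [entry_mul]
  by_cases h : ∀ i, i ∉ S → x i = y i
  · rw [if_pos h, Matrix.mul_apply]
    -- Only intermediate states agreeing with `x` off `S` contribute; `e` parametrizes them by their
    -- restriction to `S`.
    let e : (S → Fin q) → (Λ → Fin q) := fun w i => if hi : i ∈ S then w ⟨i, hi⟩ else x i
    have heS : ∀ w, (fun i : S => e w i) = w := fun w => by ext i; simp [e]
    have he : Function.Injective e := fun w w' hw => by rw [← heS w, ← heS w', hw]
    symm
    refine Fintype.sum_of_injective e he _ _ ?_ ?_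
    · intro z hz
      rw [ha, if_neg, zero_mul]
      intro hxz
      refine hz ⟨fun i => z i, funext fun i => ?_⟩
      by_cases hi : i ∈ S <;> simp [e, hi, hxz]
    · intro w
      have h1 : ∀ i, i ∉ S → e w i = x i := fun i hi => by simp [e, hi]
      rw [ha, hb, heS, if_pos fun i hi => (h1 i hi).symm,
        if_pos fun i hi => (h1 i hi).trans (h i hi)]
  · rw [if_neg h]
    refine Finset.sum_eq_zero fun z _ => ?_
    rw [ha, hb]
    by_cases h1 : ∀ i, i ∉ S → x i = z i
    · rw [if_neg (fun h2 => h fun i hi => (h1 i hi).trans (h2 i hi) : ¬ ∀ i, i ∉ S → z i = y i),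
        mul_zero]
    · rw [if_neg h1, zero_mul]

/-- Operators with disjoint supports commute. -/
lemma SupportedIn.commute {A B : Op Λ q} {S T : Finset Λ} (hA : SupportedIn A S)
    (hB : SupportedIn B T) (hST : Disjoint S T) : Commute A B := by
  classical
  have key : ∀ (A B : Op Λ q) (S T : Finset Λ), Disjoint S T → ∀ a b,
      (∀ x y, entry A x y = if ∀ i, i ∉ S → x i = y i then
        (a : Matrix (S → Fin q) (S → Fin q) ℂ) (fun i => x i) (fun i => y i) else 0) →
      (∀ x y, entry B x y = if ∀ i, i ∉ T → x i = y i then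
        (b : Matrix (T → Fin q) (T → Fin q) ℂ) (fun i => x i) (fun i => y i) else 0) →
      ∀ x y, entry (A * B) x y = if ∀ i, i ∉ S → i ∉ T → x i = y i then
        a (fun i => x i) (fun i => y i) * b (fun i => x i) (fun i => y i) else 0 := by
    intro A B S T hST a b ha hb x y
    -- A single intermediate state contributes: `A` has already acted on `S` alone. The resulting
    -- formula is symmetric in the two operators.
    rw [entry_mul, Finset.sum_eq_single (fun i => if i ∈ S then y i else x i)]
    · rw [ha, hb, if_pos (fun i hi => by simp [hi])]
      have hS : (fun i : S => if (i : Λ) ∈ S then y i else x i) = fun i : S => y i := by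
        ext i; simp
      have hT : (fun i : T => if (i : Λ) ∈ S then y i else x i) = fun i : T => x i := by
        ext i; simp [Finset.disjoint_right.1 hST i.2]
      rw [hS, hT]
      by_cases h : ∀ i, i ∉ S → i ∉ T → x i = y i
      · rw [if_pos h, if_pos]
        intro i hi
        by_cases hiS : i ∈ S
        · simp [hiS]
        · simp [hiS, h i hiS hi]
      · rw [if_neg h, if_neg, mul_zero]
        intro h'
        refine h fun i hiS hi => ?_
        simpa [hiS] using h' i hi
    · intro z _ hz
      rw [ha, hb]
      by_cases h1 : ∀ i, i ∉ S → x i = z i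
      · rw [if_neg (c := ∀ i, i ∉ T → z i = y i), mul_zero]
        intro h2
        refine hz (funext fun i => ?_)
        by_cases hi : i ∈ S
        · simp [hi, h2 i (Finset.disjoint_left.1 hST hi)]
        · simp [hi, h1 i hi]
      · rw [if_neg h1, zero_mul]
    · simp
  obtain ⟨a, ha⟩ := hA
  obtain ⟨b, hb⟩ := hB
  refine Op.ext_entry fun x y => ?_
  rw [key A B S T hST a b ha hb, key B A T S hST.symm b a hb ha]
  have : (∀ i, i ∉ S → i ∉ T → x i = y i) ↔ ∀ i, i ∉ T → i ∉ S → x i = y i :=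
    ⟨fun h i h1 h2 => h i h2 h1, fun h i h1 h2 => h i h2 h1⟩
  by_cases h : ∀ i, i ∉ S → i ∉ T → x i = y i
  · rw [if_pos h, if_pos (this.1 h), mul_comm]
  · rw [if_neg h, if_neg fun h' => h (this.2 h')]

lemma SupportedIn.eq_smul_one {A : Op Λ q} (hA : SupportedIn A ∅) :
    ∃ c : ℂ, A = c • (1 : Op Λ q) := by
  classical
  obtain ⟨a, ha⟩ := hA
  by_cases hne : Nonempty (Λ → Fin q)
  · obtain ⟨x₀⟩ := hne
    refine ⟨a (fun i => x₀ i) (fun i => x₀ i), Op.ext_entry fun x y => ?_⟩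
    rw [ha, entry_smul, entry_one]
    have hs : ∀ u v : ((∅ : Finset Λ) → Fin q), u = v := fun u v =>
      funext fun i => absurd i.2 (Finset.notMem_empty _)
    rw [hs (fun i => x i) (fun i => x₀ i), hs (fun i => y i) (fun i => x₀ i)]
    simp [funext_iff]
  · exact ⟨0, Op.ext_entry fun x => (hne ⟨x⟩).elim⟩

end Supports

/-! ### Schur tests for terms permuting orthogonal sectors -/

section Schur

variable {V : Type*} [NormedAddCommGroup V] [InnerProductSpace ℂ V]
  {σ T : Type*} [Fintype σ] [Fintype T]

lemma norm_sq_sum_of_orthogonal {w : σ → V} (h : ∀ s t, s ≠ t → inner ℂ (w s) (w t) = 0) :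
    ‖∑ s, w s‖ ^ 2 = ∑ s, ‖w s‖ ^ 2 := by
  have : inner ℂ (∑ s, w s) (∑ s, w s) = ∑ s, inner ℂ (w s) (w s) := by
    rw [sum_inner]
    refine Finset.sum_congr rfl fun s _ => ?_
    rw [inner_sum]
    exact Finset.sum_eq_single s (fun t _ ht => h s t ht.symm) (by simp)
  simp only [inner_self_eq_norm_sq_to_K] at this
  exact_mod_cast this

variable {e : T → σ → σ} {φ : σ → V} {u : T → σ → V} {b : T → σ → ℝ} {m : σ → ℝ} {C : ℝ}

/-- Regroups contributions by target sector `t`; as `e τ` is an involution, the source is `e τ t`.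
-/
lemma sum_sum_eq_of_involutive {M : Type*} [AddCommMonoid M] (he : ∀ τ, Function.Involutive (e τ))
    (g : T → σ → M) : ∑ τ, ∑ s, g τ s = ∑ t, ∑ τ, g τ (e τ t) := by
  rw [Finset.sum_comm (s := (Finset.univ : Finset σ))]
  exact Finset.sum_congr rfl fun τ _ => (Equiv.sum_comp (he τ).toPerm (g τ)).symm

/-- A Schur test for the norm of a sum of terms that permute orthogonal sectors. -/
lemma norm_sq_sum_sum_le (he : ∀ τ, Function.Involutive (e τ)) (hb : ∀ τ s, 0 ≤ b τ s)
    (hu : ∀ τ s, ‖u τ s‖ ≤ b τ s * ‖φ s‖)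
    (horth : ∀ τ τ' s s', e τ s ≠ e τ' s' → inner ℂ (u τ s) (u τ' s') = 0)
    (h1 : ∀ s, ∑ τ, b τ s ≤ m s) (h2 : ∀ t, ∑ τ, b τ (e τ t) ≤ m t)
    (h3 : ∀ τ s, b τ s * m (e τ s) ≤ C * (b τ s * m s)) (hC : 0 ≤ C) :
    ‖∑ τ, ∑ s, u τ s‖ ^ 2 ≤ C * ∑ s, m s ^ 2 * ‖φ s‖ ^ 2 := by
  have hm : ∀ s, 0 ≤ m s := fun s => (Finset.sum_nonneg fun τ _ => hb τ s).trans (h1 s)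
  rw [sum_sum_eq_of_involutive he, norm_sq_sum_of_orthogonal]
  · calc ∑ t, ‖∑ τ, u τ (e τ t)‖ ^ 2
        ≤ ∑ t, m t * ∑ τ, b τ (e τ t) * ‖φ (e τ t)‖ ^ 2 := by
          refine Finset.sum_le_sum fun t _ => ?_
          calc ‖∑ τ, u τ (e τ t)‖ ^ 2 ≤ (∑ τ, b τ (e τ t) * ‖φ (e τ t)‖) ^ 2 := by
                gcongr
                exact (norm_sum_le _ _).trans (Finset.sum_le_sum fun τ _ => hu τ _)
            _ ≤ (∑ τ, b τ (e τ t)) * ∑ τ, b τ (e τ t) * ‖φ (e τ t)‖ ^ 2 := by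
                -- Cauchy–Schwarz with weights `b`.
                refine Finset.sum_sq_le_sum_mul_sum_of_sq_le_mul _ (fun τ _ => hb _ _)
                  (fun τ _ => mul_nonneg (hb _ _) (sq_nonneg _)) fun τ _ => le_of_eq (by ring)
            _ ≤ _ := by
                gcongr
                · exact Finset.sum_nonneg fun τ _ => mul_nonneg (hb _ _) (sq_nonneg _)
                · exact h2 t
      _ = ∑ t, ∑ τ, b τ (e τ t) * m (e τ (e τ t)) * ‖φ (e τ t)‖ ^ 2 := by
          refine Finset.sum_congr rfl fun t _ => ?_
          rw [Finset.mul_sum]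
          refine Finset.sum_congr rfl fun τ _ => ?_
          rw [he τ t]; ring
      _ = ∑ τ, ∑ s, b τ s * m (e τ s) * ‖φ s‖ ^ 2 :=
          (sum_sum_eq_of_involutive he fun τ s => b τ s * m (e τ s) * ‖φ s‖ ^ 2).symm
      -- The weight sits at the target; `h3` moves it to the source, where `h1` can be summed.
      _ ≤ ∑ τ, ∑ s, C * (b τ s * m s) * ‖φ s‖ ^ 2 := by
          refine Finset.sum_le_sum fun τ _ => Finset.sum_le_sum fun s _ => ?_
          exact mul_le_mul_of_nonneg_right (h3 τ s) (sq_nonneg _)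
      _ = C * ∑ s, (∑ τ, b τ s) * (m s * ‖φ s‖ ^ 2) := by
          rw [Finset.sum_comm, Finset.mul_sum]
          refine Finset.sum_congr rfl fun s _ => ?_
          rw [Finset.sum_mul, Finset.mul_sum]
          exact Finset.sum_congr rfl fun τ _ => by ring
      _ ≤ C * ∑ s, m s ^ 2 * ‖φ s‖ ^ 2 := by
          refine mul_le_mul_of_nonneg_left (Finset.sum_le_sum fun s _ => ?_) hC
          calc (∑ τ, b τ s) * (m s * ‖φ s‖ ^ 2) ≤ m s * (m s * ‖φ s‖ ^ 2) :=
                mul_le_mul_of_nonneg_right (h1 s) (mul_nonneg (hm s) (sq_nonneg _))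
            _ = _ := by ring
  · intro t t' htt'
    rw [sum_inner]
    refine Finset.sum_eq_zero fun τ _ => ?_
    rw [inner_sum]
    refine Finset.sum_eq_zero fun τ' _ => horth _ _ _ _ ?_
    rwa [he τ t, he τ' t']

/-- A Schur test for the quadratic form of a sum of terms that permute orthogonal sectors. -/
lemma norm_inner_sum_le (he : ∀ τ, Function.Involutive (e τ)) (hb : ∀ τ s, 0 ≤ b τ s)
    (hu : ∀ τ s, ‖u τ s‖ ≤ b τ s * ‖φ s‖)
    (horth : ∀ τ s t, e τ s ≠ t → inner ℂ (φ t) (u τ s) = 0)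
    (h1 : ∀ s, ∑ τ, b τ s ≤ m s) (h2 : ∀ t, ∑ τ, b τ (e τ t) ≤ m t) :
    ‖inner ℂ (∑ s, φ s) (∑ τ, ∑ s, u τ s)‖ ≤ ∑ s, m s * ‖φ s‖ ^ 2 := by
  have hinner : inner ℂ (∑ s, φ s) (∑ τ, ∑ s, u τ s) =
      ∑ τ, ∑ s, inner ℂ (φ (e τ s)) (u τ s) := by
    rw [inner_sum]
    refine Finset.sum_congr rfl fun τ _ => ?_
    rw [inner_sum]
    refine Finset.sum_congr rfl fun s _ => ?_
    rw [sum_inner]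
    exact Finset.sum_eq_single _ (fun t _ ht => horth _ _ _ ht.symm) (by simp)
  rw [hinner]
  calc ‖∑ τ, ∑ s, inner ℂ (φ (e τ s)) (u τ s)‖
      ≤ ∑ τ, ∑ s, (b τ s * ‖φ s‖ ^ 2 / 2 + b τ s * ‖φ (e τ s)‖ ^ 2 / 2) := by
        refine (norm_sum_le _ _).trans (Finset.sum_le_sum fun τ _ => ?_)
        refine (norm_sum_le _ _).trans (Finset.sum_le_sum fun s _ => ?_)
        refine (norm_inner_le_norm _ _).trans ?_
        have h4 := mul_le_mul_of_nonneg_left (hu τ s) (norm_nonneg (φ (e τ s)))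
        -- The product of the two norms is at most half the sum of their squares.
        have h5 := mul_nonneg (hb τ s) (sq_nonneg (‖φ s‖ - ‖φ (e τ s)‖))
        nlinarith
    _ = ∑ s, (∑ τ, b τ s) * (‖φ s‖ ^ 2 / 2) + ∑ t, (∑ τ, b τ (e τ t)) * (‖φ t‖ ^ 2 / 2) := by
        simp only [Finset.sum_add_distrib, Finset.sum_mul]
        congr 1
        · rw [Finset.sum_comm]
          exact Finset.sum_congr rfl fun s _ => Finset.sum_congr rfl fun τ _ => by ring
        · conv_rhs => rw [Finset.sum_comm]
          refine Finset.sum_congr rfl fun τ _ => ?_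
          rw [← Equiv.sum_comp (he τ).toPerm]
          exact Finset.sum_congr rfl fun s _ => by
            simp only [Function.Involutive.coe_toPerm, he τ s]; ring
    _ ≤ ∑ s, m s * (‖φ s‖ ^ 2 / 2) + ∑ t, m t * (‖φ t‖ ^ 2 / 2) := by
        gcongr with s _ t _
        · exact h1 s
        · exact h2 t
    _ = _ := by
        rw [← Finset.sum_add_distrib]
        exact Finset.sum_congr rfl fun s _ => by ring

end Schur

/-! ### Even and odd parts under conjugation by an involution -/

section Reflections

variable {A : Type*} [Ring A]

lemma two_mul_sub_one_mul_self {p : A} (h : p * p = p) : (2 * p - 1) * (2 * p - 1) = 1 := by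
  have : (2 * p - 1) * (2 * p - 1) = 4 * (p * p) - 4 * p + 1 := by noncomm_ring
  rw [this, h]; simp

lemma commute_two_mul_sub_one {p r : A} (h : Commute p r) : Commute p (2 * r - 1) :=
  ((Commute.ofNat_right p 2).mul_right h).sub_right (Commute.one_right _)

lemma eq_zero_of_commute_of_anticommute [Algebra ℂ A] {z a : A} (hz : z * z = 1)
    (h1 : a * z = z * a) (h2 : a * z = -(z * a)) : a = 0 := by
  have h3 : (2 : ℂ) • (z * a) = 0 := by
    rw [two_smul]
    nth_rw 1 [← h1]
    rw [h2, neg_add_cancel]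
  have h4 : z * a = 0 := (smul_eq_zero.1 h3).resolve_left two_ne_zero
  rw [← one_mul a, ← hz, mul_assoc, h4, mul_zero]

lemma eq_half_add_half_sub {A : Type*} [AddCommGroup A] [Module ℂ A] (a b : A) :
    a = (2⁻¹ : ℂ) • (a + b) + (2⁻¹ : ℂ) • (a - b) := by
  rw [← smul_add, add_add_sub_cancel, ← two_smul ℂ a, smul_smul, inv_mul_cancel₀ two_ne_zero,
    one_smul]

lemma add_conj_mul {z : A} (hz : z * z = 1) (a : A) :
    (a + z * a * z) * z = z * (a + z * a * z) := by
  have h1 : z * a * z * z = z * a := by rw [mul_assoc, hz, mul_one]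
  have h2 : z * (z * a * z) = a * z := by rw [← mul_assoc, ← mul_assoc, hz, one_mul]
  rw [add_mul, mul_add, h1, h2, add_comm]

lemma sub_conj_mul {z : A} (hz : z * z = 1) (a : A) :
    (a - z * a * z) * z = -(z * (a - z * a * z)) := by
  have h1 : z * a * z * z = z * a := by rw [mul_assoc, hz, mul_one]
  have h2 : z * (z * a * z) = a * z := by rw [← mul_assoc, ← mul_assoc, hz, one_mul]
  rw [sub_mul, mul_sub, h1, h2, neg_sub]

/-- Conjugation by `z` preserves (anti)commutation with an element that commutes with `z`. -/
lemma add_sub_conj_mul {z w a : A} (hzw : z * w = w * z) (h : a * w = -(w * a) ∨ a * w = w * a) :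
    ((a + z * a * z) * w = -(w * (a + z * a * z)) ∨
      (a + z * a * z) * w = w * (a + z * a * z)) ∧
    ((a - z * a * z) * w = -(w * (a - z * a * z)) ∨
      (a - z * a * z) * w = w * (a - z * a * z)) := by
  have e1 : z * a * z * w = z * (a * w) * z := by
    rw [mul_assoc, hzw]; simp only [mul_assoc]
  have e2 : z * (w * a) * z = w * (z * a * z) := by
    rw [← mul_assoc, hzw]; simp only [mul_assoc]
  rcases h with h | h
  · refine ⟨.inl ?_, .inl ?_⟩
    · rw [add_mul, e1, h, mul_neg, neg_mul, e2, mul_add, neg_add]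
    · rw [sub_mul, e1, h, mul_neg, neg_mul, e2, mul_sub]; abel
  · refine ⟨.inr ?_, .inr ?_⟩
    · rw [add_mul, e1, h, e2, mul_add]
    · rw [sub_mul, e1, h, e2, mul_sub]

end Reflections

/-! ### Syndrome sectors and the decomposition of local operators -/

section Models

variable {Λ : Type} [Fintype Λ] [DecidableEq Λ] {G : SimpleGraph Λ} {q : ℕ} {ι : Type} [Fintype ι]
  {ℓ₀ : ℕ} {Δ : ℝ}

/-- A term meeting `X` is counted at least once when summing over the sites of `X`. -/
lemma sum_norm_le_localNorm (D : Finset Λ → Finset ι → Op Λ q) (X : Finset Λ) :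
    ∑ τ : Finset Λ × Finset ι, (if Disjoint τ.1 X then 0 else ‖D τ.1 τ.2‖) ≤
      X.card * localNorm D := by
  have h : ∀ i : Λ, ∑ S with i ∈ S, ∑ s, ‖D S s‖ ≤ localNorm D := fun i =>
    le_ciSup (f := fun i : Λ => ∑ S with i ∈ S, ∑ s, ‖D S s‖) (Set.finite_range _).bddAbove i
  calc ∑ τ : Finset Λ × Finset ι, (if Disjoint τ.1 X then 0 else ‖D τ.1 τ.2‖)
      ≤ ∑ τ : Finset Λ × Finset ι, ∑ i ∈ X, (if i ∈ τ.1 then ‖D τ.1 τ.2‖ else 0) := by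
        refine Finset.sum_le_sum fun τ _ => ?_
        have hnn : ∀ i ∈ X, 0 ≤ (if i ∈ τ.1 then ‖D τ.1 τ.2‖ else 0) := fun i _ => by
          split_ifs <;> positivity
        split_ifs with hd
        · exact Finset.sum_nonneg hnn
        · obtain ⟨i, hi1, hi2⟩ := Finset.not_disjoint_iff.1 hd
          refine le_trans ?_ (Finset.single_le_sum hnn hi2)
          rw [if_pos hi1]
    _ = ∑ i ∈ X, ∑ S with i ∈ S, ∑ s, ‖D S s‖ := by
        rw [Finset.sum_comm]
        refine Finset.sum_congr rfl fun i _ => ?_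
        rw [Fintype.sum_prod_type, Finset.sum_filter]
        refine Finset.sum_congr rfl fun S _ => ?_
        by_cases hi : i ∈ S <;> simp [hi]
    _ ≤ ∑ i ∈ X, localNorm D := Finset.sum_le_sum fun i _ => h i
    _ = _ := by simp

namespace CommProjModel

variable (M : CommProjModel G q ι ℓ₀ Δ)

lemma proj_proj_apply (f : ι) (v : Hilb Λ q) : M.proj f (M.proj f v) = M.proj f v :=
  DFunLike.congr_fun (M.isProj f).isIdempotentElem v

lemma inner_proj (f : ι) (v w : Hilb Λ q) : inner ℂ (M.proj f v) w = inner ℂ v (M.proj f w) :=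
  (M.isProj f).isSelfAdjoint.isSymmetric v w

/-- The joint eigenspace of the checks in which exactly the factors in `s` are violated. -/
def syndromeSpace (s : Finset ι) : Submodule ℂ (Hilb Λ q) where
  carrier := {v | (∀ f ∈ s, M.proj f v = 0) ∧ ∀ f, f ∉ s → M.proj f v = v}
  add_mem' := by
    rintro v w ⟨h1, h2⟩ ⟨h3, h4⟩
    exact ⟨fun f hf => by rw [map_add, h1 f hf, h3 f hf, add_zero],
      fun f hf => by rw [map_add, h2 f hf, h4 f hf]⟩
  zero_mem' := by simp
  smul_mem' := by
    rintro c v ⟨h1, h2⟩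
    exact ⟨fun f hf => by rw [map_smul, h1 f hf, smul_zero],
      fun f hf => by rw [map_smul, h2 f hf]⟩

variable {M}

lemma mem_syndromeSpace {s : Finset ι} {v : Hilb Λ q} : v ∈ M.syndromeSpace s ↔
    (∀ f ∈ s, M.proj f v = 0) ∧ ∀ f, f ∉ s → M.proj f v = v := Iff.rfl

lemma inner_eq_zero_of_mem_syndromeSpace {s t : Finset ι} (hst : s ≠ t) {v w : Hilb Λ q}
    (hv : v ∈ M.syndromeSpace s) (hw : w ∈ M.syndromeSpace t) : inner ℂ v w = 0 := by
  have : ∃ f, ¬ (f ∈ s ↔ f ∈ t) := by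
    by_contra h
    push Not at h
    exact hst (Finset.ext h)
  obtain ⟨f, hf⟩ := this
  by_cases hs : f ∈ s
  · have ht : f ∉ t := by tauto
    rw [← hw.2 f ht, ← M.inner_proj, hv.1 f hs, inner_zero_left]
  · have ht : f ∈ t := by tauto
    rw [← hv.2 f hs, M.inner_proj, hw.1 f ht, inner_zero_right]

lemma check_apply (f : ι) (v : Hilb Λ q) : (2 * M.proj f - 1) v = (2 : ℂ) • M.proj f v - v := by
  rw [two_mul, two_smul]; rfl

lemma check_mul_check (f : ι) : (2 * M.proj f - 1) * (2 * M.proj f - 1) = 1 := by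
  exact two_mul_sub_one_mul_self (M.isProj f).isIdempotentElem

/-- Anticommuting with a check flips its eigenvalue, commuting preserves it. -/
lemma HasSyndrome.apply_mem [DecidableEq ι] {O : Op Λ q} {s s' : Finset ι}
    (hO : M.HasSyndrome O s') {v : Hilb Λ q} (hv : v ∈ M.syndromeSpace s) :
    O v ∈ M.syndromeSpace (symmDiff s s') := by
  have hanti : ∀ f ∈ s', O ((2 : ℂ) • M.proj f v - v) = -((2 : ℂ) • M.proj f (O v) - O v) := by
    intro f hf
    rw [← check_apply, ← check_apply]
    exact DFunLike.congr_fun (hO.1 f hf) v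
  have hcomm : ∀ f, f ∉ s' → O ((2 : ℂ) • M.proj f v - v) = (2 : ℂ) • M.proj f (O v) - O v := by
    intro f hf
    rw [← check_apply, ← check_apply]
    exact DFunLike.congr_fun (hO.2 f hf) v
  have two : ∀ {a b : Hilb Λ q}, (2 : ℂ) • a = (2 : ℂ) • b → a = b := fun h =>
    smul_right_injective _ (two_ne_zero (α := ℂ)) h
  refine mem_syndromeSpace.2 ⟨fun f hf => ?_, fun f hf => ?_⟩
  · rw [Finset.mem_symmDiff] at hf
    apply two
    rcases hf with ⟨h1, h2⟩ | ⟨h1, h2⟩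
    · have := hcomm f h2
      rw [hv.1 f h1, smul_zero, zero_sub, map_neg] at this
      rw [smul_zero, ← sub_eq_zero.2 this.symm]; abel
    · have := hanti f h1
      rw [hv.2 f h2, map_sub, map_smul] at this
      have h3 : O v = -((2 : ℂ) • M.proj f (O v) - O v) := by
        rw [← this, two_smul]; abel
      rw [smul_zero, ← sub_eq_zero.2 h3]; abel
  · rw [Finset.mem_symmDiff] at hf
    apply two
    by_cases h1 : f ∈ s
    · have h2 : f ∈ s' := by tauto
      have := hanti f h2
      rw [hv.1 f h1, smul_zero, zero_sub, map_neg, neg_inj] at this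
      rw [two_smul _ (O v)]
      nth_rw 2 [this]; abel
    · have h2 : f ∉ s' := by tauto
      have := hcomm f h2
      rw [hv.2 f h1, map_sub, map_smul] at this
      exact (sub_left_inj.1 this).symm

lemma ham_apply_of_mem {s : Finset ι} {v : Hilb Λ q} (hv : v ∈ M.syndromeSpace s) :
    M.ham v = (∑ f ∈ s, M.coupling f : ℝ) • v := by
  classical
  have : M.ham v = ∑ f, (M.coupling f : ℂ) • (v - M.proj f v) := by
    simp [ham]
  rw [this, Finset.sum_smul, ← Finset.sum_subset (Finset.subset_univ s)]
  · refine Finset.sum_congr rfl fun f hf => ?_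
    rw [hv.1 f hf, sub_zero]; rfl
  · intro f _ hf
    rw [hv.2 f hf, sub_self, smul_zero]

lemma localProj_apply_eq_self {S : Finset Λ} {v : Hilb Λ q}
    (h : ∀ f, M.supp f ⊆ S → M.proj f v = v) : M.localProj S v = v := by
  refine Finset.noncommProd_induction _ _ _ (fun A : Op Λ q => A v = v) ?_ rfl ?_
  · intro A B hA hB
    change A (B v) = v
    rw [hB, hA]
  · intro f hf
    exact h f (Finset.mem_filter.1 hf).2

lemma proj_localProj_apply {S : Finset Λ} {f : ι} (hf : M.supp f ⊆ S) (v : Hilb Λ q) :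
    M.proj f (M.localProj S v) = M.localProj S v := by
  classical
  have h := Finset.mul_noncommProd_erase (Finset.univ.filter fun f => M.supp f ⊆ S)
    (a := f) (by simpa using hf) M.proj (fun f _ g _ _ => M.comm f g)
  change M.proj f * _ = M.localProj S at h
  rw [← h]
  exact M.proj_proj_apply f _

lemma localProj_apply_eq_zero {S : Finset Λ} {f : ι} (hf : M.supp f ⊆ S) {v : Hilb Λ q}
    (hv : M.proj f v = 0) : M.localProj S v = 0 := by
  classical
  have h := Finset.noncommProd_erase_mul (Finset.univ.filter fun f => M.supp f ⊆ S)
    (a := f) (by simpa using hf) M.proj (fun f _ g _ _ => M.comm f g)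
  change _ * M.proj f = M.localProj S at h
  rw [← h]
  change (_ : Op Λ q) (M.proj f v) = 0
  rw [hv, map_zero]

lemma IsGroundState.mem_syndromeSpace {ψ : Hilb Λ q} (h : M.IsGroundState ψ) :
    ψ ∈ M.syndromeSpace ∅ := by
  refine ⟨by simp, fun f _ => ?_⟩
  have := proj_localProj_apply (M := M) (Finset.subset_univ (M.supp f)) ψ
  rwa [h.2] at this

/-- A projector with empty support is a scalar; fixing the ground state it equals `1`, so it is
never violated. Hence every violated factor contributes error sites. -/
lemma IsGroundState.supp_nonempty {ψ : Hilb Λ q} (h : M.IsGroundState ψ) {s : Finset ι}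
    {v : Hilb Λ q} (hv : v ∈ M.syndromeSpace s) (hv0 : v ≠ 0) {f : ι} (hf : f ∈ s) :
    (M.supp f).Nonempty := by
  rw [Finset.nonempty_iff_ne_empty]
  intro he
  have hs := M.supported f
  rw [he] at hs
  obtain ⟨c, hc⟩ := hs.eq_smul_one
  have h1 := hv.1 f hf
  have h2 := h.mem_syndromeSpace.2 f (Finset.notMem_empty f)
  rw [hc] at h1 h2
  change c • v = 0 at h1
  change c • ψ = ψ at h2
  rcases smul_eq_zero.1 h1 with rfl | h3
  · exact h.1 (by rw [← h2, zero_smul])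
  · exact hv0 h3

lemma HasSyndrome.eq_zero_of_commute {O : Op Λ q} {s : Finset ι} (hO : M.HasSyndrome O s) {f : ι}
    (hf : f ∈ s) (h : Commute (M.proj f) O) : O = 0 := by
  exact eq_zero_of_commute_of_anticommute (check_mul_check f)
    (commute_two_mul_sub_one h.symm).eq (hO.1 f hf)

variable (M) in
/-- The set of sites on which the factors in `s` act. -/
def errorSites (s : Finset ι) : Finset Λ := s.biUnion M.supp

variable (M) in
/-- The span of the vectors `O ψ` with `O` of syndrome `s` and strongly supported in a set of at
most `n` sites. -/
def localSyndromeSpace (ψ : Hilb Λ q) (n : ℝ) (s : Finset ι) : Submodule ℂ (Hilb Λ q) :=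
  Submodule.span ℂ {φ | ∃ (S : Finset Λ) (O : Op Λ q), (S.card : ℝ) ≤ n ∧
    M.StronglySupported O S ∧ M.HasSyndrome O s ∧ φ = O ψ}

lemma IsGroundState.localSyndromeSpace_le {ψ : Hilb Λ q} (h : M.IsGroundState ψ) (n : ℝ)
    (s : Finset ι) : M.localSyndromeSpace ψ n s ≤ M.syndromeSpace s := by
  classical
  refine Submodule.span_le.2 ?_
  rintro _ ⟨S, O, -, -, hO, rfl⟩
  have := hO.apply_mem h.mem_syndromeSpace
  rwa [← Finset.bot_eq_empty, bot_symmDiff] at this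

lemma StronglySupported.add {A B : Op Λ q} {S : Finset Λ} (hA : M.StronglySupported A S)
    (hB : M.StronglySupported B S) : M.StronglySupported (A + B) S :=
  ⟨hA.1.add hB.1, fun f hf => (hA.2 f hf).add_right (hB.2 f hf)⟩

lemma StronglySupported.mul {A B : Op Λ q} {S : Finset Λ} (hA : M.StronglySupported A S)
    (hB : M.StronglySupported B S) : M.StronglySupported (A * B) S :=
  ⟨hA.1.mul hB.1, fun f hf => (hA.2 f hf).mul_right (hB.2 f hf)⟩

lemma StronglySupported.sub {A B : Op Λ q} {S : Finset Λ} (hA : M.StronglySupported A S)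
    (hB : M.StronglySupported B S) : M.StronglySupported (A - B) S :=
  ⟨hA.1.sub hB.1, fun f hf => (hA.2 f hf).sub_right (hB.2 f hf)⟩

lemma check_comm (f g : ι) : Commute (M.proj f) (2 * M.proj g - 1) :=
  commute_two_mul_sub_one (M.comm f g)

lemma check_check_comm (f g : ι) : Commute (2 * M.proj f - 1) (2 * M.proj g - 1) :=
  commute_two_mul_sub_one (check_comm g f).symm

lemma stronglySupported_check {f : ι} {S : Finset Λ} (h : M.supp f ⊆ S) :
    M.StronglySupported (2 * M.proj f - 1) S := by
  refine ⟨?_, fun g _ => check_comm g f⟩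
  rw [two_mul]
  exact (((M.supported f).mono h).add ((M.supported f).mono h)).sub (supportedIn_one S)

/-- A strongly supported operator is a combination of strongly supported operators that commute or
anticommute with each of the given checks. -/
lemma StronglySupported.mem_span {O : Op Λ q} {S : Finset Λ} (hO : M.StronglySupported O S)
    (A : Finset ι) : O ∈ Submodule.span ℂ {O' : Op Λ q | M.StronglySupported O' S ∧
      ∀ f ∈ A, O' * (2 * M.proj f - 1) = -((2 * M.proj f - 1) * O') ∨
        O' * (2 * M.proj f - 1) = (2 * M.proj f - 1) * O'} := by
  classical
  induction A using Finset.induction_on with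
  | empty => exact Submodule.subset_span ⟨hO, by simp⟩
  | insert f A _ ih =>
    refine (Submodule.span_le.2 ?_ : _ ≤ _) ih
    rintro O' ⟨hO', hA⟩
    by_cases hf : M.supp f ⊆ S
    -- Split into the parts commuting and anticommuting with `Z`. Strong support in `S` survives
    -- because `Z` itself is strongly supported there; if the factor is not inside `S`, no splitting
    -- is needed.
    · let Z := 2 * M.proj f - 1
      have hZZ : Z * Z = 1 := check_mul_check f
      have hZs : M.StronglySupported Z S := stronglySupported_check hf
      have hconj : M.StronglySupported (Z * O' * Z) S := (hZs.mul hO').mul hZs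
      have hg := fun g (hgA : g ∈ A) => add_sub_conj_mul (check_check_comm f g).eq (hA g hgA)
      rw [eq_half_add_half_sub O' (Z * O' * Z)]
      refine add_mem (Submodule.smul_mem _ _ (Submodule.subset_span ⟨hO'.add hconj, ?_⟩))
        (Submodule.smul_mem _ _ (Submodule.subset_span ⟨hO'.sub hconj, ?_⟩))
      · intro g hgA
        rcases Finset.mem_insert.1 hgA with rfl | hgA
        · exact .inr (add_conj_mul hZZ O')
        · exact (hg g hgA).1
      · intro g hgA
        rcases Finset.mem_insert.1 hgA with rfl | hgA
        · exact .inl (sub_conj_mul hZZ O')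
        · exact (hg g hgA).2
    · refine Submodule.subset_span ⟨hO', fun g hgA => ?_⟩
      rcases Finset.mem_insert.1 hgA with rfl | hgA
      · right
        exact (commute_two_mul_sub_one (hO'.2 g hf).symm).eq
      · exact hA g hgA

lemma StronglySupported.exists_sum {O : Op Λ q} {S : Finset Λ} (hO : M.StronglySupported O S)
    {n : ℝ} (hS : (S.card : ℝ) ≤ n) (ψ : Hilb Λ q) :
    ∃ φ : Finset ι → Hilb Λ q, (∀ s, φ s ∈ M.localSyndromeSpace ψ n s) ∧ O ψ = ∑ s, φ s := by
  classical
  have h := hO.mem_span Finset.univ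
  clear hO
  induction h using Submodule.span_induction with
  | mem O h =>
    obtain ⟨hO, h⟩ := h
    let s : Finset ι := Finset.univ.filter fun f =>
      ¬ O * (2 * M.proj f - 1) = (2 * M.proj f - 1) * O
    have hs : M.HasSyndrome O s := by
      refine ⟨fun f hf => (h f (Finset.mem_univ f)).resolve_right (Finset.mem_filter.1 hf).2,
        fun f hf => ?_⟩
      by_contra h'
      exact hf (Finset.mem_filter.2 ⟨Finset.mem_univ f, h'⟩)
    refine ⟨Pi.single s (O ψ), fun t => ?_, by simp⟩
    rcases eq_or_ne t s with rfl | hts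
    · rw [Pi.single_eq_same]
      exact Submodule.subset_span ⟨S, O, hS, hO, hs, rfl⟩
    · rw [Pi.single_eq_of_ne hts]
      exact zero_mem _
  | zero => exact ⟨0, fun s => zero_mem _, by simp⟩
  | add A B _ _ ihA ihB =>
    obtain ⟨φ, h1, h2⟩ := ihA
    obtain ⟨χ, h3, h4⟩ := ihB
    exact ⟨φ + χ, fun s => add_mem (h1 s) (h3 s), by
      simp [h2, h4, Finset.sum_add_distrib]⟩
  | smul c A _ ih =>
    obtain ⟨φ, h1, h2⟩ := ih
    exact ⟨c • φ, fun s => Submodule.smul_mem _ _ (h1 s), by simp [h2, Finset.smul_sum]⟩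

end CommProjModel

end Models

/-! ### Excitations and the locality of the perturbation -/

section Excitations

variable {Λ : Type} [Fintype Λ] [DecidableEq Λ] {G : SimpleGraph Λ} {q : ℕ} {ι : Type} [Fintype ι]
  {ℓ₀ : ℕ} {Δ : ℝ} {M : CommProjModel G q ι ℓ₀ Δ} {d : ℕ} {c R' n K : ℝ} {ψ : Hilb Λ q}

namespace CommProjModel

/-- A local operator with a given syndrome acts on the ground state like an operator supported in
the filled set of errors. -/
lemma LocallyNondegenerate.exists_supportedIn_filled (hnd : M.LocallyNondegenerate d c R' ψ)
    (hn : n ≤ c * R' ^ d) {S : Finset Λ} {s : Finset ι} {O : Op Λ q} (hS : (S.card : ℝ) ≤ n)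
    (hOS : M.StronglySupported O S) (hOs : M.HasSyndrome O s) :
    ∃ O' : Op Λ q, SupportedIn O' (filled G n (M.errorSites s)) ∧ O ψ = O' ψ := by
  by_cases hO : O = 0
  · refine ⟨0, ⟨0, fun x y => ?_⟩, by rw [hO]⟩
    simp [entry]
  have hsS : ∀ f ∈ s, M.supp f ⊆ S := by
    intro f hf
    by_contra h
    exact hO (hOs.eq_zero_of_commute hf (hOS.2 f h))
  have hne : ∀ f ∈ s, (M.supp f).Nonempty := by
    intro f hf
    rw [Finset.nonempty_iff_ne_empty]
    intro he
    refine hO (hOs.eq_zero_of_commute hf ((M.supported f).commute hOS.1 ?_))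
    rw [he]
    exact Finset.disjoint_empty_left _
  obtain ⟨F, hFS, hBF, hF, hadj⟩ := exists_subset_filled (G := G) (B := M.errorSites s) hS
    (Finset.biUnion_subset.2 hsS)
  obtain ⟨O', h1, -, -, h2⟩ := hnd S s O (hS.trans hn) hOS hOs hsS F hFS (fun f hf => by
    rw [Finset.inter_eq_left.2 ((Finset.subset_biUnion_of_mem M.supp hf).trans hBF)]
    exact hne f hf) hadj
  exact ⟨O', h1.mono hF, h2⟩

/-- Without errors the filling is empty, so the replacing operator is a scalar. -/
lemma LocallyNondegenerate.localSyndromeSpace_empty_le (hnd : M.LocallyNondegenerate d c R' ψ)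
    (hn : n ≤ c * R' ^ d)
    (hfill : ∀ B : Finset Λ, ((filled G n B).card : ℝ) ≤ K * B.card) :
    M.localSyndromeSpace ψ n ∅ ≤ Submodule.span ℂ {ψ} := by
  refine Submodule.span_le.2 ?_
  rintro _ ⟨S, O, hS, hOS, hOs, rfl⟩
  obtain ⟨O', h1, h2⟩ := hnd.exists_supportedIn_filled hn hS hOS hOs
  have hem : filled G n (M.errorSites ∅) = ∅ := by
    have := hfill (M.errorSites ∅)
    rw [← Finset.card_eq_zero, ← Nat.le_zero]
    simpa [errorSites] using this
  rw [hem] at h1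
  obtain ⟨a, rfl⟩ := h1.eq_smul_one
  rw [h2]
  exact Submodule.smul_mem _ a (Submodule.mem_span_singleton_self ψ)

/-- Excitations are sums of vectors of nontrivial syndromes. -/
lemma LocallyNondegenerate.exists_sum_of_mem_excitations (hψ : M.IsGroundState ψ)
    (hnd : M.LocallyNondegenerate d c R' ψ) (hn : n ≤ c * R' ^ d)
    (hfill : ∀ B : Finset Λ, ((filled G n B).card : ℝ) ≤ K * B.card) {v : Hilb Λ q}
    (hv : v ∈ M.excitations ψ n) :
    ∃ φ : Finset ι → Hilb Λ q, (∀ s, φ s ∈ M.localSyndromeSpace ψ n s) ∧ φ ∅ = 0 ∧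
      v = ∑ s, φ s := by
  classical
  induction hv using Submodule.span_induction with
  | mem v hv =>
    obtain ⟨S, O, hS, hO, rfl⟩ := hv
    obtain ⟨φ, h1, h2⟩ := hO.exists_sum hS ψ
    obtain ⟨a, ha⟩ := Submodule.mem_span_singleton.1
      (hnd.localSyndromeSpace_empty_le hn hfill (h1 ∅))
    have hψψ : inner ℂ ψ ψ ≠ 0 := inner_self_ne_zero.2 hψ.1
    -- All other sectors are orthogonal to `ψ`, so subtracting the expectation removes exactly the
    -- component of trivial syndrome.
    have hexp : expect O ψ = a := by
      have : inner ℂ ψ (O ψ) = a * inner ℂ ψ ψ := by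
        rw [h2, inner_sum, Finset.sum_eq_single ∅, ← ha, inner_smul_right]
        · intro s _ hs
          exact inner_eq_zero_of_mem_syndromeSpace hs.symm hψ.mem_syndromeSpace
            (hψ.localSyndromeSpace_le n s (h1 s))
        · simp
      rw [expect, this, mul_div_cancel_right₀ _ hψψ]
    refine ⟨Function.update φ ∅ 0, fun s => ?_, Function.update_self .., ?_⟩
    · rcases eq_or_ne s ∅ with rfl | hs
      · rw [Function.update_self]; exact zero_mem _
      · rw [Function.update_of_ne hs]; exact h1 s
    · rw [fluct, hexp, ha, h2, Finset.sum_update_of_mem (Finset.mem_univ _), zero_add,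
        ← Finset.sum_sdiff (Finset.subset_univ {(∅ : Finset ι)}), Finset.sum_singleton,
        add_sub_cancel_right]
  | zero => exact ⟨0, fun s => zero_mem _, rfl, by simp⟩
  | add v w _ _ ihv ihw =>
    obtain ⟨φ, h1, h2, h3⟩ := ihv
    obtain ⟨χ, h4, h5, h6⟩ := ihw
    exact ⟨φ + χ, fun s => add_mem (h1 s) (h4 s), by simp [h2, h5], by
      simp [h3, h6, Finset.sum_add_distrib]⟩
  | smul a v _ ih =>
    obtain ⟨φ, h1, h2, h3⟩ := ih
    exact ⟨a • φ, fun s => Submodule.smul_mem _ _ (h1 s), by simp [h2], by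
      simp [h3, Finset.smul_sum]⟩

lemma excitations_eq_bot (hψ : M.IsGroundState ψ) (hn : n < 1) : M.excitations ψ n = ⊥ := by
  rw [excitations, Submodule.span_eq_bot]
  rintro _ ⟨S, O, hS, hO, rfl⟩
  have hS0 : S = ∅ := by
    rw [← Finset.card_eq_zero, ← Nat.lt_one_iff]
    exact_mod_cast hS.trans_lt hn
  rw [hS0] at hO
  obtain ⟨a, rfl⟩ := hO.1.eq_smul_one
  have h : (a • (1 : Op Λ q)) ψ = a • ψ := rfl
  rw [fluct, expect, h, inner_smul_right, mul_div_cancel_right₀ _ (inner_self_ne_zero.2 hψ.1),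
    sub_self]

/-- A term that does not annihilate a vector of syndrome `s` acts close to the errors of `s`, and
close to the errors of the syndrome of the image. -/
lemma LocallyNondegenerate.active [DecidableEq ι] (hψ : M.IsGroundState ψ)
    (hnd : M.LocallyNondegenerate d c R' ψ)
    (hn : n ≤ c * R' ^ d) {S : Finset Λ} {s s' : Finset ι} {D : Op Λ q}
    (hDS : SupportedIn D S) (hDs : M.HasSyndrome D s') (hs' : ∀ f ∈ s', M.supp f ⊆ S)
    (hDP : Commute D (M.localProj S)) (hDψ : D ψ = 0) {v : Hilb Λ q}
    (hv : v ∈ M.localSyndromeSpace ψ n s) (hDv : D v ≠ 0) :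
    ¬ Disjoint S (filled G n (M.errorSites s)) ∧
      ¬ Disjoint S (filled G n (M.errorSites (symmDiff s s'))) := by
  have hv' := hψ.localSyndromeSpace_le n s hv
  have hDv' : D v ∈ M.syndromeSpace (symmDiff s s') := hDs.apply_mem hv'
  have hDPv : ∀ w, D (M.localProj S w) = M.localProj S (D w) := fun w =>
    DFunLike.congr_fun hDP.eq w
  have key : ∀ (t : Finset ι) (w : Hilb Λ q), w ∈ M.syndromeSpace t → w ≠ 0 →
      (∃ f ∈ t, M.supp f ⊆ S) → ¬ Disjoint S (filled G n (M.errorSites t)) := by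
    rintro t w hw hw0 ⟨f, hf, hfS⟩
    obtain ⟨i, hi⟩ := hψ.supp_nonempty hw hw0 hf
    exact Finset.not_disjoint_iff.2 ⟨i, hfS hi,
      subset_filled (Finset.mem_biUnion.2 ⟨f, hf, hi⟩)⟩
  by_cases h : ∃ f ∈ s, M.supp f ⊆ S
  · have hv0 : v ≠ 0 := by
      rintro rfl
      exact hDv (map_zero D)
    refine ⟨key s v hv' hv0 h, key _ _ hDv' hDv ?_⟩
    by_contra hcon
    push Not at hcon
    obtain ⟨f, hf, hfS⟩ := h
    -- If the image had no error inside `S`, it would be fixed by `P_S`; but `P_S D v = D P_S v =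
    -- 0`.
    have h1 : M.localProj S (D v) = D v := localProj_apply_eq_self fun g hg =>
      hDv'.2 g fun hgt => hcon g hgt hg
    rw [← hDPv, localProj_apply_eq_zero hfS (hv'.1 f hf), map_zero] at h1
    exact hDv h1.symm
  · push Not at h
    have h1 : M.localProj S v = v := localProj_apply_eq_self fun g hg =>
      hv'.2 g fun hgs => h g hgs hg
    have h2 := hDPv v
    rw [h1] at h2
    -- Without errors of `v` inside `S`, also `P_S D v = D v`, so `D` creates no error and source
    -- and target sectors coincide.
    have hs0 : s' = ∅ := by
      by_contra hne
      obtain ⟨f, hf⟩ := Finset.nonempty_iff_ne_empty.2 hne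
      have hft : f ∈ symmDiff s s' :=
        Finset.mem_symmDiff.2 (.inr ⟨hf, fun hfs => h f hfs (hs' f hf)⟩)
      have h3 := proj_localProj_apply (M := M) (hs' f hf) (D v)
      rw [← h2, hDv'.1 f hft] at h3
      exact hDv h3.symm
    have hst : symmDiff s s' = s := by rw [hs0, ← Finset.bot_eq_empty, symmDiff_bot]
    rw [hst, and_self_iff]
    intro hdisj
    refine hDv ?_
    -- The filling depends on `s` and `n` only, so one disjointness assumption serves all
    -- generators, whatever their supports.
    have hle : M.localSyndromeSpace ψ n s ≤ LinearMap.ker (D : Hilb Λ q →ₗ[ℂ] Hilb Λ q) := by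
      refine Submodule.span_le.2 ?_
      rintro _ ⟨S₁, O, hS₁, hOS, hOs, rfl⟩
      obtain ⟨O', h3, h4⟩ := hnd.exists_supportedIn_filled hn hS₁ hOS hOs
      change D (O ψ) = 0
      have h5 : D (O' ψ) = O' (D ψ) := DFunLike.congr_fun (hDS.commute h3 hdisj).eq ψ
      rw [h4, h5, hDψ, map_zero]
    exact hle hv

end CommProjModel

end Excitations

/-! ### Relative bounds and metastability -/

section Bounds

variable {Λ : Type} [Fintype Λ] [DecidableEq Λ] {G : SimpleGraph Λ} {q : ℕ} {ι : Type} [Fintype ι]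
  {ℓ₀ : ℕ} {Δ : ℝ} {M : CommProjModel G q ι ℓ₀ Δ} {d : ℕ} {c R' n K C : ℝ} {ψ : Hilb Λ q}
  {D : Finset Λ → Finset ι → Op Λ q}

open CommProjModel

lemma total_sum_apply (D : Finset Λ → Finset ι → Op Λ q) (φ : Finset ι → Hilb Λ q) :
    total D (∑ s, φ s) = ∑ τ : Finset Λ × Finset ι, ∑ s, D τ.1 τ.2 (φ s) := by
  rw [Fintype.sum_prod_type]
  simp only [total, FunLike.coe_sum, Finset.sum_apply, map_sum]
  rw [Finset.sum_comm]
  exact Finset.sum_congr rfl fun S _ => Finset.sum_comm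

/-- The perturbation is bounded, in the sense of forms and of norms, by the number of sites at
which errors occur. -/
lemma total_bounds (hψ : M.IsGroundState ψ) (hnd : M.LocallyNondegenerate d c R' ψ)
    (hn : n ≤ c * R' ^ d) (hK : 0 ≤ K)
    (hfill : ∀ B : Finset Λ, ((filled G n B).card : ℝ) ≤ K * B.card)
    (hdec : M.IsSyndromeDecomposition D) (hblock : M.IsLocallyBlockDiagonal D)
    (hDψ : ∀ S s, D S s ψ = 0) (hC : 0 ≤ C)
    (hcard : ∀ S s, D S s ≠ 0 → (S.card : ℝ) ≤ C) {φ : Finset ι → Hilb Λ q}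
    (hφ : ∀ s, φ s ∈ M.localSyndromeSpace ψ n s) (hφ0 : φ ∅ = 0) :
    ‖total D (∑ s, φ s)‖ ^ 2 ≤ (1 + C) *
        ∑ s, (localNorm D * K * (M.errorSites s).card) ^ 2 * ‖φ s‖ ^ 2 ∧
      ‖inner ℂ (∑ s, φ s) (total D (∑ s, φ s))‖ ≤
        ∑ s, (localNorm D * K * (M.errorSites s).card) * ‖φ s‖ ^ 2 := by
  classical
  let e : Finset Λ × Finset ι → Finset ι → Finset ι := fun τ s => symmDiff s τ.2
  -- Inactive terms get weight zero, so that only terms meeting the filling are summed, at the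
  -- source and at the target.
  let b : Finset Λ × Finset ι → Finset ι → ℝ := fun τ s =>
    if D τ.1 τ.2 (φ s) = 0 then 0 else ‖D τ.1 τ.2‖
  have he : ∀ τ, Function.Involutive (e τ) := fun τ s => symmDiff_symmDiff_cancel_right τ.2 s
  have hb : ∀ τ s, 0 ≤ b τ s := fun τ s => by
    simp only [b]; split_ifs <;> positivity
  have hu : ∀ τ s, ‖D τ.1 τ.2 (φ s)‖ ≤ b τ s * ‖φ s‖ := fun τ s => by
    simp only [b]
    split_ifs with h
    · rw [h]; simp
    · exact (D τ.1 τ.2).le_opNorm _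
  have hφ' : ∀ s, φ s ∈ M.syndromeSpace s := fun s => hψ.localSyndromeSpace_le n s (hφ s)
  have hmem : ∀ τ s, D τ.1 τ.2 (φ s) ∈ M.syndromeSpace (e τ s) := fun τ s => by
    by_cases h : D τ.1 τ.2 = 0
    · rw [h]; exact zero_mem _
    · exact (hdec _ _ h).2.2.2.apply_mem (hφ' s)
  have hD0 : ∀ τ : Finset Λ × Finset ι, ∀ s, D τ.1 τ.2 (φ s) ≠ 0 → D τ.1 τ.2 ≠ 0 :=
    fun τ s h h' => h (by rw [h']; rfl)
  have hact : ∀ τ : Finset Λ × Finset ι, ∀ s, D τ.1 τ.2 (φ s) ≠ 0 →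
      ¬ Disjoint τ.1 (filled G n (M.errorSites s)) ∧
        ¬ Disjoint τ.1 (filled G n (M.errorSites (e τ s))) := by
    intro τ s h
    obtain ⟨-, h1, h2, h3⟩ := hdec _ _ (hD0 τ s h)
    exact hnd.active hψ hn h2.1 h3 h1 (hblock _ _) (hDψ _ _) (hφ s) h
  have hLN : 0 ≤ localNorm D := by
    refine Real.iSup_nonneg fun i => ?_
    positivity
  have hsum : ∀ s (g : Finset Λ × Finset ι → ℝ),
      (∀ τ, g τ ≤ if Disjoint τ.1 (filled G n (M.errorSites s)) then 0 else ‖D τ.1 τ.2‖) →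
      ∑ τ, g τ ≤ localNorm D * K * (M.errorSites s).card := by
    intro s g hg
    refine (Finset.sum_le_sum fun τ _ => hg τ).trans
      ((sum_norm_le_localNorm D _).trans ?_)
    have := mul_le_mul_of_nonneg_right (hfill (M.errorSites s)) hLN
    linarith
  have h1 : ∀ s, ∑ τ, b τ s ≤ localNorm D * K * (M.errorSites s).card := by
    refine fun s => hsum s _ fun τ => ?_
    simp only [b]
    by_cases h : D τ.1 τ.2 (φ s) = 0
    · rw [if_pos h]; split_ifs <;> positivity
    · rw [if_neg h, if_neg (hact τ s h).1]
  have h2 : ∀ t, ∑ τ, b τ (e τ t) ≤ localNorm D * K * (M.errorSites t).card := by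
    refine fun t => hsum t _ fun τ => ?_
    simp only [b]
    by_cases h : D τ.1 τ.2 (φ (e τ t)) = 0
    · rw [if_pos h]; split_ifs <;> positivity
    · have := (hact τ _ h).2
      rw [he τ t] at this
      rw [if_neg h, if_neg this]
  -- A term adds at most `C` error sites, and there is at least one beforehand since `φ ∅ = 0`;
  -- hence the ratio `1 + C`.
  have h3 : ∀ τ s, b τ s * (localNorm D * K * (M.errorSites (e τ s)).card) ≤
      (1 + C) * (b τ s * (localNorm D * K * (M.errorSites s).card)) := by
    intro τ s
    by_cases h : D τ.1 τ.2 (φ s) = 0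
    · simp [b, h]
    have hφs : φ s ≠ 0 := fun h' => h (by rw [h', map_zero])
    have hs : s.Nonempty := by
      rw [Finset.nonempty_iff_ne_empty]
      rintro rfl
      exact hφs hφ0
    obtain ⟨f, hf⟩ := hs
    obtain ⟨i, hi⟩ := hψ.supp_nonempty (hφ' s) hφs hf
    have hone : (1 : ℝ) ≤ (M.errorSites s).card := by
      exact_mod_cast Finset.card_pos.2 ⟨i, Finset.mem_biUnion.2 ⟨f, hf, hi⟩⟩
    have hsub : M.errorSites (e τ s) ⊆ M.errorSites s ∪ τ.1 := by
      refine Finset.biUnion_subset.2 fun g hg => ?_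
      rcases Finset.mem_symmDiff.1 hg with hg | hg
      · exact (Finset.subset_biUnion_of_mem M.supp hg.1).trans Finset.subset_union_left
      · exact ((hdec _ _ (hD0 τ s h)).2.1 g hg.1).trans Finset.subset_union_right
    have hle : ((M.errorSites (e τ s)).card : ℝ) ≤ (M.errorSites s).card + τ.1.card := by
      exact_mod_cast (Finset.card_le_card hsub).trans (Finset.card_union_le _ _)
    have hle2 : ((M.errorSites (e τ s)).card : ℝ) ≤ (1 + C) * (M.errorSites s).card := by
      have := hcard _ _ (hD0 τ s h)
      nlinarith
    calc b τ s * (localNorm D * K * (M.errorSites (e τ s)).card)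
        ≤ b τ s * (localNorm D * K * ((1 + C) * (M.errorSites s).card)) := by
          have := hb τ s
          gcongr
      _ = _ := by ring
  rw [total_sum_apply]
  refine ⟨norm_sq_sum_sum_le he hb hu ?_ h1 h2 h3 (by positivity),
    norm_inner_sum_le he hb hu ?_ h1 h2⟩
  · exact fun τ τ' s s' h => inner_eq_zero_of_mem_syndromeSpace h (hmem τ s) (hmem τ' s')
  · exact fun τ s t h => inner_eq_zero_of_mem_syndromeSpace h.symm (hφ' t) (hmem τ s)

lemma ham_sum_apply {φ : Finset ι → Hilb Λ q} (hφ : ∀ s, φ s ∈ M.syndromeSpace s) :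
    M.ham (∑ s, φ s) = ∑ s, (∑ f ∈ s, M.coupling f : ℝ) • φ s := by
  rw [map_sum]
  exact Finset.sum_congr rfl fun s _ => ham_apply_of_mem (hφ s)

lemma norm_ham_sum_sq {φ : Finset ι → Hilb Λ q} (hφ : ∀ s, φ s ∈ M.syndromeSpace s) :
    ‖M.ham (∑ s, φ s)‖ ^ 2 = ∑ s, (∑ f ∈ s, M.coupling f) ^ 2 * ‖φ s‖ ^ 2 := by
  rw [ham_sum_apply hφ, norm_sq_sum_of_orthogonal]
  · refine Finset.sum_congr rfl fun s _ => ?_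
    rw [norm_smul, mul_pow, Real.norm_eq_abs, sq_abs]
  · intro s t hst
    exact inner_eq_zero_of_mem_syndromeSpace hst
      ((M.syndromeSpace s).smul_of_tower_mem _ (hφ s))
      ((M.syndromeSpace t).smul_of_tower_mem _ (hφ t))

lemma re_inner_ham_sum {φ : Finset ι → Hilb Λ q} (hφ : ∀ s, φ s ∈ M.syndromeSpace s) :
    (inner ℂ (∑ s, φ s) (M.ham (∑ s, φ s))).re =
      ∑ s, (∑ f ∈ s, M.coupling f) * ‖φ s‖ ^ 2 := by
  have : inner ℂ (∑ s, φ s) (M.ham (∑ s, φ s)) =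
      ∑ s, (((∑ f ∈ s, M.coupling f) * ‖φ s‖ ^ 2 : ℝ) : ℂ) := by
    rw [ham_sum_apply hφ, sum_inner]
    refine Finset.sum_congr rfl fun s _ => ?_
    rw [inner_sum, Finset.sum_eq_single s]
    · rw [inner_smul_right_eq_smul, Complex.real_smul, inner_self_eq_norm_sq_to_K]
      push_cast; rfl
    · intro t _ ht
      exact inner_eq_zero_of_mem_syndromeSpace ht.symm (hφ s)
        ((M.syndromeSpace t).smul_of_tower_mem _ (hφ t))
    · simp
  rw [this, ← Complex.ofReal_sum, Complex.ofReal_re]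

lemma mul_card_le_sum_coupling (s : Finset ι) : Δ * s.card ≤ ∑ f ∈ s, M.coupling f := by
  rw [mul_comm, ← nsmul_eq_mul]
  exact Finset.card_nsmul_le_sum _ _ _ fun f _ => M.le_coupling f

lemma card_errorSites_le {C₀ : ℝ} (h : ∀ f, ((M.supp f).card : ℝ) ≤ C₀) (s : Finset ι) :
    ((M.errorSites s).card : ℝ) ≤ C₀ * s.card := by
  calc ((M.errorSites s).card : ℝ) ≤ ((∑ f ∈ s, (M.supp f).card : ℕ) : ℝ) := by
        exact_mod_cast Finset.card_biUnion_le
    _ ≤ ∑ f ∈ s, C₀ := by push_cast; exact Finset.sum_le_sum fun f _ => h f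
    _ = _ := by simp [mul_comm]

lemma IsGroundState.ham_apply (hψ : M.IsGroundState ψ) : M.ham ψ = 0 := by
  rw [ham_apply_of_mem hψ.mem_syndromeSpace]; simp

lemma fluct_mem_excitations {S : Finset Λ} {O : Op Λ q} (hS : (S.card : ℝ) ≤ n)
    (hO : M.StronglySupported O S) : fluct O ψ ∈ M.excitations ψ n :=
  Submodule.subset_span ⟨S, O, hS, hO, rfl⟩

/-- A relative bound by the number of errors gives metastability. -/
lemma metastable_of_bounds {C₀ ε : ℝ} (hψ : M.IsGroundState ψ)
    (hnd : M.LocallyNondegenerate d c R' ψ)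
    (hn : n ≤ c * R' ^ d) (hΔ : 0 < Δ) (hK : 0 ≤ K)
    (hfill : ∀ B : Finset Λ, ((filled G n B).card : ℝ) ≤ K * B.card)
    (hdec : M.IsSyndromeDecomposition D) (hblock : M.IsLocallyBlockDiagonal D)
    (hDψ : ∀ S s, D S s ψ = 0) (hC : 0 ≤ C)
    (hcard : ∀ S s, D S s ≠ 0 → (S.card : ℝ) ≤ C)
    (hsupp : ∀ f, ((M.supp f).card : ℝ) ≤ C₀) (hLN : 0 ≤ localNorm D)
    (hε : localNorm D * K * C₀ ≤ ε * Δ) (hε0 : 0 ≤ ε) (hε1 : (1 + C) * ε ≤ 1 / 2) :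
    ∀ v ∈ M.excitations ψ n, ‖total D v‖ ≤ 1 / 2 * ‖M.ham v‖ ∧
      ((Δ / 2 : ℝ) : EReal) ≤ avgEnergy (M.ham + total D) v := by
  intro v hv
  obtain ⟨φ, hφ, hφ0, rfl⟩ := hnd.exists_sum_of_mem_excitations hψ hn hfill hv
  have hφ' : ∀ s, φ s ∈ M.syndromeSpace s := fun s => hψ.localSyndromeSpace_le n s (hφ s)
  obtain ⟨hb1, hb2⟩ := total_bounds hψ hnd hn hK hfill hdec hblock hDψ hC hcard hφ hφ0
  set E : Finset ι → ℝ := fun s => ∑ f ∈ s, M.coupling f with hE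
  have hm : ∀ s, localNorm D * K * (M.errorSites s).card ≤ ε * E s := by
    intro s
    calc localNorm D * K * (M.errorSites s).card ≤ localNorm D * K * (C₀ * s.card) := by
          gcongr; exact card_errorSites_le hsupp s
      _ = localNorm D * K * C₀ * s.card := by ring
      _ ≤ ε * Δ * s.card := by gcongr
      _ = ε * (Δ * s.card) := by ring
      _ ≤ ε * E s := by gcongr; exact mul_card_le_sum_coupling s
  have hE0 : ∀ s, 0 ≤ E s := fun s =>
    (mul_nonneg hΔ.le (Nat.cast_nonneg _)).trans (mul_card_le_sum_coupling s)
  have hε2 : ε ≤ 1 / 2 := by nlinarith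
  constructor
  · refine abs_le_of_sq_le_sq' ?_ (by positivity) |>.2
    calc ‖total D (∑ s, φ s)‖ ^ 2
        ≤ (1 + C) * ∑ s, (localNorm D * K * (M.errorSites s).card) ^ 2 * ‖φ s‖ ^ 2 := hb1
      _ ≤ (1 + C) * ∑ s, (ε * E s) ^ 2 * ‖φ s‖ ^ 2 := by
          refine mul_le_mul_of_nonneg_left (Finset.sum_le_sum fun s _ => ?_) (by positivity)
          exact mul_le_mul_of_nonneg_right (pow_le_pow_left₀ (by positivity) (hm s) 2)
            (sq_nonneg _)
      _ = ((1 + C) * ε * ε) * ‖M.ham (∑ s, φ s)‖ ^ 2 := by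
          rw [norm_ham_sum_sq hφ', Finset.mul_sum, Finset.mul_sum]
          exact Finset.sum_congr rfl fun s _ => by simp only [hE]; ring
      _ ≤ (1 / 2 * (1 / 2)) * ‖M.ham (∑ s, φ s)‖ ^ 2 := by gcongr
      _ = (1 / 2 * ‖M.ham (∑ s, φ s)‖) ^ 2 := by ring
  · rw [avgEnergy]
    split_ifs with hv0
    · exact le_top
    · rw [EReal.coe_le_coe_iff]
      set v := ∑ s, φ s with hvdef
      have hvv : inner ℂ v v = ((‖v‖ ^ 2 : ℝ) : ℂ) := by
        rw [inner_self_eq_norm_sq_to_K]; push_cast; rfl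
      have hvpos : 0 < ‖v‖ ^ 2 := by positivity
      have hre : (expect (M.ham + total D) v).re =
          ((inner ℂ v (M.ham v)).re + (inner ℂ v (total D v)).re) / ‖v‖ ^ 2 := by
        rw [expect, hvv, Complex.div_ofReal_re]
        congr 1
        rw [← Complex.add_re, ← inner_add_right]; rfl
      rw [hre, le_div_iff₀ hvpos, re_inner_ham_sum hφ', norm_sq_sum_of_orthogonal
        (fun s t hst => inner_eq_zero_of_mem_syndromeSpace hst (hφ' s) (hφ' t))]
      have h1 : -(∑ s, ε * E s * ‖φ s‖ ^ 2) ≤ (inner ℂ v (total D v)).re := by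
        refine neg_le_of_abs_le ((Complex.abs_re_le_norm _).trans (hb2.trans ?_))
        exact Finset.sum_le_sum fun s _ => mul_le_mul_of_nonneg_right (hm s) (sq_nonneg _)
      have h2 : Δ / 2 * ∑ s, ‖φ s‖ ^ 2 ≤ ∑ s, (E s * ‖φ s‖ ^ 2 - ε * E s * ‖φ s‖ ^ 2) := by
        rw [Finset.mul_sum]
        refine Finset.sum_le_sum fun s _ => ?_
        -- The trivial sector is absent; every other one has `E s ≥ Δ` and loses at most half of its
        -- energy, as `ε ≤ 1 / 2`.
        rcases s.eq_empty_or_nonempty with rfl | hs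
        · simp [hφ0]
        · have h3 : Δ ≤ E s := by
            refine le_trans ?_ (mul_card_le_sum_coupling s)
            have : (1 : ℝ) ≤ s.card := by exact_mod_cast hs.card_pos
            nlinarith
          have h4 : Δ / 2 ≤ E s - ε * E s := by nlinarith [hE0 s]
          have := mul_le_mul_of_nonneg_right h4 (sq_nonneg ‖φ s‖)
          linarith
      rw [Finset.sum_sub_distrib] at h2
      linarith

end Bounds

end Metastable
end

/-! ### Choice of constants and conclusion -/

theorem mainTheorem6 (d : ℕ) (hd : 1 ≤ d) (c_d c_bd : ℝ) (hc_d : 0 < c_d) (hc_bd : 0 < c_bd)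
    (ℓ₀ ℓ_D : ℕ) :
    ∃ c_R : ℝ, 0 < c_R ∧
      ∀ (Λ : Type) [Fintype Λ] [DecidableEq Λ] (G : SimpleGraph Λ) (q : ℕ)
        (ι : Type) [Fintype ι] (Δ R' : ℝ)
        (M : Metastable.CommProjModel G q ι ℓ₀ Δ)
        (ψ₀ : Metastable.Hilb Λ q)
        (D : Finset Λ → Finset ι → Metastable.Op Λ q) (R : ℝ),
        G.Connected →
        Metastable.IsDimensional G d c_d →
        0 < Δ →
        M.IsGroundState ψ₀ →
        M.LocallyNondegenerate d c_d R' ψ₀ →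
        M.IsSyndromeDecomposition D →
        IsSelfAdjoint (Metastable.total D) →
        M.IsLocallyBlockDiagonal D →
        (∀ S s, D S s ψ₀ = 0) →
        Metastable.HasRange G D ℓ_D →
        0 < Metastable.localNorm D →
        R = c_R * Δ / Metastable.localNorm D →
        R < R' →
        Metastable.HasBoundaryGrowth G d c_bd (c_d * R ^ d) →
        Metastable.avgEnergy (M.ham + Metastable.total D) ψ₀ = 0 ∧
        (∀ (S : Finset Λ) (O : Metastable.Op Λ q), (S.card : ℝ) ≤ c_d * R ^ d →
          M.StronglySupported O S →
          ((Δ / 2 : ℝ) : EReal) ≤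
            Metastable.avgEnergy (M.ham + Metastable.total D) (Metastable.fluct O ψ₀)) ∧
        ∀ ψ ∈ M.excitations ψ₀ (c_d * R ^ d),
          ‖Metastable.total D ψ‖ ≤ 1 / 2 * ‖M.ham ψ‖ := by
  -- `C₀` bounds the size of a factor, `C` the size of the set of a term, `δ` the size of a unit
  -- ball, and `K₁ * R` the filling ratio. The choice of `c_R` makes `localNorm D * (K₁ * R) * C₀`
  -- equal to `ε Δ` with `ε = 1 / (2 (1 + C))`.
  set C₀ : ℝ := c_d * (max 1 (2 * (ℓ₀ : ℝ))) ^ d with hC₀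
  set C : ℝ := c_d * (max 1 (2 * (ℓ_D : ℝ))) ^ d with hC
  set δ : ℝ := c_d * (max 1 (2 * ((1 : ℕ) : ℝ))) ^ d with hδ
  set K₁ : ℝ := c_d ^ (1 / (d : ℝ)) * (1 + δ / c_bd) with hK₁
  have hC₀pos : 0 < C₀ := by positivity
  have hCpos : 0 < C := by positivity
  have hδpos : 0 < δ := by positivity
  have hK₁pos : 0 < K₁ := by positivity
  refine ⟨1 / (2 * (1 + C) * (K₁ * C₀)), by positivity, ?_⟩
  intro Λ _ _ G q ι _ Δ R' M ψ₀ D R hG hdim hΔ hψ hnd hdec _ hblock hDψ hrange hLN hR hRR' hgrowth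
  have hLNR : Metastable.localNorm D * R = 1 / (2 * (1 + C) * (K₁ * C₀)) * Δ := by
    rw [hR, mul_div_cancel₀ _ hLN.ne']
  have hRpos : 0 < R := by rw [hR]; positivity
  set n : ℝ := c_d * R ^ d with hn
  have hnR' : n ≤ c_d * R' ^ d :=
    mul_le_mul_of_nonneg_left (pow_le_pow_left₀ hRpos.le hRR'.le d) hc_d.le
  have hd0 : (d : ℝ) ≠ 0 := by exact_mod_cast (by omega : d ≠ 0)
  have hroot : n ^ (1 / (d : ℝ)) = c_d ^ (1 / (d : ℝ)) * R := by
    rw [hn, Real.mul_rpow hc_d.le (by positivity), ← Real.rpow_natCast, ← Real.rpow_mul hRpos.le,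
      mul_one_div_cancel hd0, Real.rpow_one]
  have hfill := Metastable.card_filled_le (G := G) hc_bd (by positivity) hgrowth
    (δ := δ) (fun i => hdim.card_distBall_le hc_d hG i 1)
  have htotal : Metastable.total D ψ₀ = 0 := by
    simp only [Metastable.total, FunLike.coe_sum, Finset.sum_apply, hDψ, Finset.sum_const_zero]
  have hmain : ∀ v ∈ M.excitations ψ₀ n, ‖Metastable.total D v‖ ≤ 1 / 2 * ‖M.ham v‖ ∧
      ((Δ / 2 : ℝ) : EReal) ≤ Metastable.avgEnergy (M.ham + Metastable.total D) v := by
    -- For `n < 1` only scalars are allowed and there are no excitations. For `n ≥ 1` the summand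
    -- `1` in the filling ratio is absorbed into `n^(1/d)`, making the ratio linear in `R`.
    rcases lt_or_ge n 1 with hn1 | hn1
    · intro v hv
      rw [Metastable.CommProjModel.excitations_eq_bot hψ hn1, Submodule.mem_bot] at hv
      subst hv
      simp [Metastable.avgEnergy]
    · refine Metastable.metastable_of_bounds (C := C) (C₀ := C₀) (ε := 1 / (2 * (1 + C))) hψ hnd
        hnR' hΔ (by positivity) hfill hdec hblock hDψ hCpos.le
        (fun S s h => hdim.card_le_of_setDiam_le hc_d hG (hrange S s h))
        (fun f => hdim.card_le_of_setDiam_le hc_d hG (M.range_le f)) hLN.le ?_ (by positivity)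
        (le_of_eq (by field_simp))
      have hroot1 : 1 ≤ n ^ (1 / (d : ℝ)) := Real.one_le_rpow hn1 (by positivity)
      have hK : 1 + n ^ (1 / (d : ℝ)) / c_bd * δ ≤ K₁ * R := by
        calc 1 + n ^ (1 / (d : ℝ)) / c_bd * δ
            ≤ n ^ (1 / (d : ℝ)) + n ^ (1 / (d : ℝ)) / c_bd * δ := by gcongr
          _ = K₁ * R := by rw [hroot, hK₁]; ring
      calc Metastable.localNorm D * (1 + n ^ (1 / (d : ℝ)) / c_bd * δ) * C₀
          ≤ Metastable.localNorm D * (K₁ * R) * C₀ := by gcongr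
        _ = Metastable.localNorm D * R * (K₁ * C₀) := by ring
        _ = 1 / (2 * (1 + C)) * Δ := by rw [hLNR]; field_simp
  refine ⟨?_, fun S O hS hO => (hmain _ (Metastable.fluct_mem_excitations hS hO)).2,
    fun v hv => (hmain v hv).1⟩
  have h0 : (M.ham + Metastable.total D) ψ₀ = 0 := by
    change M.ham ψ₀ + Metastable.total D ψ₀ = 0
    rw [Metastable.IsGroundState.ham_apply hψ, htotal, add_zero]
  rw [Metastable.avgEnergy, if_neg hψ.1, Metastable.expect, h0]
  simp
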